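/- Let $L,T>0$, $\varepsilon>0$ and $\Omega=(-L,0)$, $\Gamma_0=\{0\}$, $\Gamma_1=\{-L\}$. Let $X$ be the closure of $\mathcal D(\overline\Omega)$ for the norm $\|u\|_X=\big(\|u\|_{L^2(\Omega)}^2+\varepsilon\|u\|_{L^2(\partial\Omega)}^2\big)^{1/2}$ (so $X\cong L^2(-L,0)\times\mathbb R^2$). For $\varphi_T\in X$ let $\varphi\in C([0,T],X)$ be the weak (semigroup) solution of the adjoint system $$\begin{cases}\varphi_t+\varphi_x+\varepsilon\varphi_{xx}=0 & \text{in }(0,T)\times\Omega,\\ \varepsilon(\varphi_t-\partial_\nu\varphi)-\varphi=0 & \text{on }(0,T)\times\Gamma_0,\\ \varphi_t-\partial_\nu\varphi=0 & \text{on }(0,T)\times\Gamma_1,\\ \varphi(T,\cdot)=\varphi_T & \text{in }\Omega,\end{cases}$$ that is, of $\dot\varphi+\mathcal A^*\varphi=0$, $\varphi(T)=\varphi_T$, where $\mathcal A^*$ is the adjoint in $X$ of the operator $\mathcal A$ defined on its domain by $a(u,v)=\langle-\mathcal A u,v\rangle_X$ for all $v\in H^1(\Omega)$, with $a(u,v)=\varepsilon\int_\Omega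 u_xv_x+\int_\Omega u_xv+u(-L)v(-L)$ on $H^1(\Omega)$. Let the observability constant $C_{T}(\varepsilon)\in[0,\infty]$ be the smallest $K$ such that $$\|\varphi(0,\cdot)\|_X\le K\,\|\varphi\|_{L^2((0,T)\times\Gamma_0)}\qquad\text{for all }\varphi_T\in X$$ ($\infty$ if there is no such $K$). Then for $T/L-1$ sufficiently large and $\varepsilon$ sufficiently small, $C_T(\varepsilon)$ is exponentially small in $1/\varepsilon$. Precisely: there is a constant $c'>0$ such that for all $L,T>0$ with $T/L>8+32c'$ there exist $C,k,\varepsilon_0>0$ such that $$C_T(\varepsilon)\le C\exp\!\left(-\frac{k}{\varepsilon}\right)\qquad\text{for all }0<\varepsilon<\varepsilon_0 .$$ -/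

import Mathlib

open MeasureTheory Set Filter Topology
open scoped NNReal ENNReal

/-- The measure `dx` on `Ω = (-L, 0)` plus `ε` times the surface measure of
`∂Ω = Γ₁ ∪ Γ₀ = {-L} ∪ {0}`, so that
`∫ u² ∂μ = ‖u‖²_{L²(Ω)} + ε ‖u‖²_{L²(∂Ω)}`. -/
noncomputable def bulkBoundaryMeasure (ε L : ℝ) : Measure ℝ :=
  volume.restrict (Ioo (-L) 0) +
    ENNReal.ofReal ε • (Measure.dirac (-L) + Measure.dirac (0 : ℝ))

/-- The Hilbert space `X`, the closure of `𝒟([-L, 0])` for the norm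
`‖u‖_X = (‖u‖²_{L²(Ω)} + ε ‖u‖²_{L²(∂Ω)})^{1/2}`. Smooth functions are dense in `L²` of a finite
measure on the line, so this closure is all of `L²(μ)`, that is, `L²(-L, 0) × ℝ²`. As `0` and `-L`
are atoms (for `ε > 0`), the values of an element of `X` at these two points are well defined;
they are its boundary components. -/
abbrev StateSpace (ε L : ℝ) : Type := Lp ℝ 2 (bulkBoundaryMeasure ε L)

/-- On `[-L, 0]`, `u` is the (absolutely) continuous representative of an element of the Sobolev
space `V = H¹(-L, 0)`, with weak derivative `u' ∈ L²(-L, 0)`. -/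
structure IsH1 (L : ℝ) (u u' : ℝ → ℝ) : Prop where
  memLp : MemLp u' 2 (volume.restrict (Ioo (-L) 0))
  eq_integral : ∀ x ∈ Icc (-L) 0, u x = u (-L) + ∫ y in (-L)..x, u' y

/-- The bilinear form on `H¹(-L, 0)`
`a(u, v) = ε ∫_Ω u_x v_x + ∫_Ω u_x v + ∫_{Γ₁} u v`
(functions are given together with their weak derivatives). -/
noncomputable def formA (ε L : ℝ) (u u' v v' : ℝ → ℝ) : ℝ :=
  ε * (∫ x in (-L)..0, u' x * v' x) + (∫ x in (-L)..0, u' x * v x) + u (-L) * v (-L)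

/-- `IsAdjointValue ε L φ w` means: `φ ∈ D(A*)` and `A* φ = w`. Here `A` is the operator of the
direct problem, `a(u, v) = ⟨-A u, v⟩_X`, so that `A*` is given by `φ ∈ H¹(-L, 0)` and
`a(v, φ) = ⟨-w, v⟩_X` for all `v ∈ H¹(-L, 0)`. Integrating by parts, this says `φ ∈ H²(-L, 0)`,
`w = ε φ_xx + φ_x` in `Ω`, `ε w = -ε ∂_ν φ - φ` on `Γ₀` and `w = -∂_ν φ` on `Γ₁`. -/
def IsAdjointValue (ε L : ℝ) (φ w : StateSpace ε L) : Prop :=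
  ∃ u u' : ℝ → ℝ, IsH1 L u u' ∧ φ =ᵐ[bulkBoundaryMeasure ε L] u ∧
    ∀ v v' : ℝ → ℝ, IsH1 L v v' →
      formA ε L v v' u u' = -∫ x, w x * v x ∂(bulkBoundaryMeasure ε L)

/-- `φ ∈ C([0, T], X)` is the weak solution of the adjoint system
`φ_t + φ_x + ε φ_xx = 0` in `(0, T) × Ω`, `ε (φ_t - ∂_ν φ) - φ = 0` on `(0, T) × Γ₀`,
`φ_t - ∂_ν φ = 0` on `(0, T) × Γ₁`, `φ(T) = φT`, that is, of `φ_t + A* φ = 0`, `φ(T) = φT`,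
in the integrated (mild) sense `φ(t) - φT = A* ∫_t^T φ(s) ds`, which characterizes the orbit
`φ(t) = e^{(T - t) A*} φT` of the semigroup generated by `A*`. -/
structure IsAdjointSolution (ε L T : ℝ) (φT : StateSpace ε L) (φ : ℝ → StateSpace ε L) :
    Prop where
  continuousOn : ContinuousOn φ (Icc 0 T)
  final : φ T = φT
  mild : ∀ t ∈ Icc 0 T, IsAdjointValue ε L (∫ s in t..T, φ s) (φ t - φT)

/-- The observability inequality on `Γ₀ = {0}` with constant `K`:
`‖φ(0)‖_X ≤ K ‖φ‖_{L²((0,T) × Γ₀)}` for every `φT ∈ X`. -/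
def ObservabilityInequality (ε L T : ℝ) (K : ℝ≥0) : Prop :=
  ∀ (φT : StateSpace ε L) (φ : ℝ → StateSpace ε L), IsAdjointSolution ε L T φT φ →
    ‖φ 0‖ ≤ K * Real.sqrt (∫ t in (0 : ℝ)..T, ((φ t : ℝ → ℝ) 0) ^ 2)

/-- The observability constant (the cost of the null-control): the smallest constant in the
observability inequality, and `∞` if there is none. -/
noncomputable def observabilityConstant (ε L T : ℝ) : ℝ≥0∞ :=
  ⨅ (K : ℝ≥0) (_ : ObservabilityInequality ε L T K), (K : ℝ≥0∞)

/-! Reverse time, `z τ = φ (T - τ)`, so that formally `z' = A* z`. The weight `e^{x/ε}` turns the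
drift-diffusion `ε ∂ₓₓ + ∂ₓ` with its dynamic boundary conditions into an operator that is symmetric
for `weightedForm` and bounded above by `-1/(4ε)` (`isSymmetricDissipative_isAdjointValue`). Hence
the weighted energy decays like `e^{-t/(2ε)}`, while passing from it to the norm of `X` costs only
`e^{L/ε}`. It remains to observe the weighted energy at time `L` from the trace on `(0, L)` at a
cost `e^{cL/ε}` with `c` absolute; for `T/L` large the decay on `(L, T)` wins.

The observation is a sideways argument: the equation is solved in `x`, starting from the trace at
`0`. Integrate the orbit against the derivatives `κₙ` of a bump of Gevrey class 2 on `(0, L)`. The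
moments `ωₙ = ∫ κₙ z` satisfy `A* ωₙ = -ωₙ₊₁` formally, and inverting `A*` from the trace at `0`
expresses `e^{x/ε} ωₙ` through `ωₙ(0)` and a Volterra integral of `ωₙ₊₁`. Each step gains two
integrations in `x` and loses one derivative of the bump, whose size is about `n!²`, comparable with
`(2n)!`; the recursion therefore converges and bounds `ω₀` by the trace
(`abs_le_of_sideways_recursion`, `IsMildOrbit.abs_exp_mul_orbitMoment_le`).

Finally `ω₀` controls `z L`: by symmetry `β(z τ, z L)` is the energy at the midpoint `(τ + L)/2`,
which is at least the energy at `L`. Pairing `ω₀` with `z L` and applying Cauchy–Schwarz gives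
`IsMildOrbit.weightedForm_le_observation`. -/

/-! ### A bump function of Gevrey class 2 -/

open scoped Nat in
-- A single term of the exponential series at `c / d`. Flatness of the bump at the endpoints is
-- traded for negative powers of the distance `d`, at the price of a factorial.
theorem inv_pow_mul_exp_neg_div_le {c d : ℝ} (hc : 0 < c) (hd : 0 < d) (n : ℕ) :
    (1 / d) ^ n * Real.exp (-(c / d)) ≤ n ! / c ^ n := by
  have h := Real.pow_div_factorial_le_exp (x := c / d) (by positivity) n
  have hn : (0 : ℝ) < n ! := by exact_mod_cast Nat.factorial_pos n
  rw [Real.exp_neg, ← div_eq_mul_inv, div_le_div_iff₀ (Real.exp_pos _) (by positivity)]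
  rw [div_le_iff₀ hn] at h
  calc (1 / d) ^ n * c ^ n = (c / d) ^ n := by rw [← mul_pow]; congr 1; ring
    _ ≤ n ! * Real.exp (c / d) := by linarith

theorem Complex.re_inv_ge_of_norm_sub_le {t : ℝ} (ht : 0 < t) {z : ℂ} (hz : ‖z - t‖ ≤ t / 2) :
    2 / (9 * t) ≤ (z⁻¹).re := by
  have hre : |z.re - t| ≤ t / 2 := by
    simpa using (Complex.abs_re_le_norm (z - t)).trans hz
  have hnorm : ‖z‖ ≤ 3 * t / 2 := by
    have := norm_add_le (z - t) (t : ℂ)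
    rw [sub_add_cancel, Complex.norm_real, Real.norm_of_nonneg ht.le] at this
    linarith
  have hre' : t / 2 ≤ z.re := by linarith [(abs_le.1 hre).1]
  have hzpos : 0 < Complex.normSq z := by
    rw [Complex.normSq_pos]
    rintro rfl
    simp at hre'
    linarith
  rw [Complex.inv_re, div_le_div_iff₀ (by positivity) hzpos, Complex.normSq_eq_norm_sq]
  have := norm_nonneg z
  nlinarith

theorem Complex.re_inv_nonneg_of_norm_sub_le {t r : ℝ} (ht : r ≤ t) {z : ℂ} (hz : ‖z - t‖ ≤ r) :
    0 ≤ (z⁻¹).re := by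
  have hre : |z.re - t| ≤ r := by
    simpa using (Complex.abs_re_le_norm (z - t)).trans hz
  rw [Complex.inv_re]
  exact div_nonneg (by linarith [(abs_le.1 hre).1]) (Complex.normSq_nonneg z)

/-- The function `exp (-M / z - M / (θ - z))`. -/
noncomputable def complexBump (θ M : ℝ) (z : ℂ) : ℂ :=
  Complex.exp (-M * z⁻¹ - M * ((θ : ℂ) - z)⁻¹)

/-- The `n`-th derivative of the bump function `exp (-M / τ - M / (θ - τ))` on `(0, θ)`, extended
by `0`. -/
noncomputable def gevreyBump (θ M : ℝ) (n : ℕ) (τ : ℝ) : ℝ :=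
  if τ ∈ Ioo 0 θ then (iteratedDeriv n (complexBump θ M) τ).re else 0

theorem analyticAt_complexBump {θ M : ℝ} {z : ℂ} (h0 : z ≠ 0) (h1 : z ≠ θ) :
    AnalyticAt ℂ (complexBump θ M) z := by
  have h1' : (θ : ℂ) - z ≠ 0 := sub_ne_zero.2 h1.symm
  unfold complexBump
  fun_prop (disch := assumption)

theorem norm_complexBump (θ M : ℝ) (z : ℂ) :
    ‖complexBump θ M z‖ = Real.exp (-(M * (z⁻¹).re) - M * (((θ : ℂ) - z)⁻¹).re) := by
  rw [complexBump, Complex.norm_exp]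
  congr 1
  simp

open scoped Nat in
-- Cauchy's estimate on the circle of radius `d / 2`, where `d` is the distance to the nearer
-- endpoint. On that circle the term of the nearer endpoint has real part at least `2 / (9 d)`, and
-- the other one is nonnegative.
theorem norm_iteratedDeriv_complexBump_le {θ M τ : ℝ} (hM : 0 < M) (hτ : τ ∈ Ioo 0 θ) (n : ℕ) :
    ‖iteratedDeriv n (complexBump θ M) τ‖ ≤
      n ! * (2 / min τ (θ - τ)) ^ n * Real.exp (-(2 * M / 9 / min τ (θ - τ))) := by
  obtain ⟨h0, h1⟩ := hτ
  set d := min τ (θ - τ) with hd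
  have hdpos : 0 < d := lt_min h0 (by linarith)
  have hdτ : d ≤ τ := min_le_left _ _
  have hdθ : d ≤ θ - τ := min_le_right _ _
  have hball : ∀ z : ℂ, ‖z - τ‖ ≤ d / 2 →
      z ≠ 0 ∧ z ≠ θ ∧ ‖((θ : ℂ) - z) - ((θ - τ : ℝ) : ℂ)‖ ≤ d / 2 := by
    intro z hz
    refine ⟨?_, ?_, ?_⟩
    · rintro rfl
      simp only [zero_sub, norm_neg, Complex.norm_real, Real.norm_of_nonneg h0.le] at hz
      linarith
    · rintro rfl
      rw [← Complex.ofReal_sub, Complex.norm_real, Real.norm_of_nonneg (by linarith)] at hz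
      linarith
    · rw [show (θ : ℂ) - z - ((θ - τ : ℝ) : ℂ) = -(z - τ) by push_cast; ring, norm_neg]
      exact hz
  have hC : ∀ z ∈ Metric.sphere (τ : ℂ) (d / 2),
      ‖complexBump θ M z‖ ≤ Real.exp (-(2 * M / 9 / d)) := by
    intro z hz
    rw [mem_sphere_iff_norm] at hz
    obtain ⟨-, -, hz'⟩ := hball z hz.le
    rw [norm_complexBump]
    have a1 := Complex.re_inv_nonneg_of_norm_sub_le (by linarith) hz.le
    have a2 := Complex.re_inv_nonneg_of_norm_sub_le (by linarith) hz'
    have key : 2 / (9 * d) ≤ (z⁻¹).re + (((θ : ℂ) - z)⁻¹).re := by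
      rcases min_choice τ (θ - τ) with h | h
      · have : d = τ := h
        have := Complex.re_inv_ge_of_norm_sub_le (t := d) hdpos (z := z) (by rw [this] at hz ⊢; exact hz.le)
        linarith
      · have : d = θ - τ := h
        have := Complex.re_inv_ge_of_norm_sub_le (t := d) hdpos (z := (θ : ℂ) - z)
          (by rw [this] at hz' ⊢; exact hz')
        linarith
    apply Real.exp_le_exp.2
    have : 2 * M / 9 / d = M * (2 / (9 * d)) := by field_simp
    rw [this]
    nlinarith [mul_le_mul_of_nonneg_left key hM.le]
  have hdiff : DiffContOnCl ℂ (complexBump θ M) (Metric.ball (τ : ℂ) (d / 2)) := by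
    apply DifferentiableOn.diffContOnCl
    intro z hz
    have hz := Metric.closure_ball_subset_closedBall hz
    rw [mem_closedBall_iff_norm] at hz
    obtain ⟨z0, z1, -⟩ := hball z hz
    exact (analyticAt_complexBump z0 z1).differentiableAt.differentiableWithinAt
  refine (Complex.norm_iteratedDeriv_le_of_forall_mem_sphere_norm_le n (by positivity) hdiff
    hC).trans (le_of_eq ?_)
  rw [div_pow, div_pow]
  field_simp

open scoped Nat in
-- One factorial comes from Cauchy's estimate, the other from absorbing `d⁻ⁿ` into the exponential.
theorem abs_gevreyBump_le {θ M : ℝ} (hM : 0 < M) (n : ℕ) (τ : ℝ) :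
    |gevreyBump θ M n τ| ≤ (n ! : ℝ) ^ 2 * (9 / M) ^ n := by
  unfold gevreyBump
  split_ifs with h
  · have hd : 0 < min τ (θ - τ) := lt_min h.1 (by linarith [h.2])
    refine (Complex.abs_re_le_norm _).trans
      ((norm_iteratedDeriv_complexBump_le hM h n).trans ?_)
    have := inv_pow_mul_exp_neg_div_le (c := 2 * M / 9) (by positivity) hd n
    calc _ = n ! * 2 ^ n * ((1 / min τ (θ - τ)) ^ n * Real.exp (-(2 * M / 9 / min τ (θ - τ)))) := by
            rw [div_pow, div_pow]; ring
      _ ≤ n ! * 2 ^ n * (n ! / (2 * M / 9) ^ n) := by gcongr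
      _ = _ := by
          rw [div_pow, div_pow, mul_pow]
          field_simp
  · rw [abs_zero]
    positivity

open scoped Nat in
-- Absorbing one more power of `1 / d` leaves a spare factor `d`, which yields continuity at the
-- endpoints.
theorem abs_gevreyBump_le_mul_min {θ M : ℝ} (hM : 0 < M) (n : ℕ) {τ : ℝ} (hτ : τ ∈ Icc 0 θ) :
    |gevreyBump θ M n τ| ≤ n ! * 2 ^ n * ((n + 1)! / (2 * M / 9) ^ (n + 1)) * min τ (θ - τ) := by
  unfold gevreyBump
  split_ifs with h
  · have hd : 0 < min τ (θ - τ) := lt_min h.1 (by linarith [h.2])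
    refine (Complex.abs_re_le_norm _).trans
      ((norm_iteratedDeriv_complexBump_le hM h n).trans ?_)
    have := inv_pow_mul_exp_neg_div_le (c := 2 * M / 9) (by positivity) hd (n + 1)
    calc _ = n ! * 2 ^ n * ((1 / min τ (θ - τ)) ^ (n + 1) *
              Real.exp (-(2 * M / 9 / min τ (θ - τ)))) * min τ (θ - τ) := by
            rw [div_pow, div_pow, one_pow]; field_simp; ring
      _ ≤ n ! * 2 ^ n * ((n + 1)! / (2 * M / 9) ^ (n + 1)) * min τ (θ - τ) := by gcongr
  · have : 0 ≤ min τ (θ - τ) := le_min hτ.1 (by linarith [hτ.2])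
    rw [abs_zero]
    positivity

theorem gevreyBump_zero_left (θ M : ℝ) (n : ℕ) : gevreyBump θ M n 0 = 0 := by
  simp [gevreyBump]

theorem gevreyBump_zero_right (θ M : ℝ) (n : ℕ) : gevreyBump θ M n θ = 0 := by
  simp [gevreyBump]

theorem hasDerivAt_gevreyBump (θ M : ℝ) (n : ℕ) {τ : ℝ} (hτ : τ ∈ Ioo 0 θ) :
    HasDerivAt (gevreyBump θ M n) (gevreyBump θ M (n + 1) τ) τ := by
  have h0 : (τ : ℂ) ≠ 0 := by exact_mod_cast hτ.1.ne'
  have h1 : (τ : ℂ) ≠ θ := by exact_mod_cast hτ.2.ne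
  have h := (((analyticAt_complexBump (M := M) h0 h1).iterated_deriv n).differentiableAt).hasDerivAt
  rw [← iteratedDeriv_eq_iterate, ← iteratedDeriv_succ] at h
  have h2 := h.real_of_complex
  have e : gevreyBump θ M (n + 1) τ = (iteratedDeriv (n + 1) (complexBump θ M) τ).re := by
    simp only [gevreyBump, if_pos hτ]
  rw [e]
  refine h2.congr_of_eventuallyEq ?_
  filter_upwards [Ioo_mem_nhds hτ.1 hτ.2] with s hs
  simp only [gevreyBump, if_pos hs]

theorem continuousOn_gevreyBump {θ M : ℝ} (hM : 0 < M) (n : ℕ) :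
    ContinuousOn (gevreyBump θ M n) (Icc 0 θ) := by
  intro τ hτ
  by_cases h : τ ∈ Ioo 0 θ
  · exact (hasDerivAt_gevreyBump θ M n h).continuousAt.continuousWithinAt
  · have hmin : min τ (θ - τ) = 0 := by
      rcases eq_or_lt_of_le hτ.1 with h0 | h0
      · subst h0
        simpa using hτ.2
      · have : θ ≤ τ := not_lt.1 fun h' => h ⟨h0, h'⟩
        have : τ = θ := le_antisymm hτ.2 this
        subst this
        simpa using hτ.1
    have h0 : gevreyBump θ M n τ = 0 := by simp only [gevreyBump, if_neg h]
    rw [ContinuousWithinAt, h0]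
    refine squeeze_zero_norm' (a := fun s => (n.factorial * 2 ^ n *
        ((n + 1).factorial / (2 * M / 9) ^ (n + 1))) * min s (θ - s)) ?_ ?_
    · filter_upwards [self_mem_nhdsWithin] with s hs
      exact abs_gevreyBump_le_mul_min hM n hs
    · have hc : Continuous fun s : ℝ => (n.factorial * 2 ^ n *
          ((n + 1).factorial / (2 * M / 9) ^ (n + 1))) * min s (θ - s) := by fun_prop
      have := hc.continuousWithinAt (s := Icc 0 θ) (x := τ)
      rw [ContinuousWithinAt] at this
      simpa [hmin] using this

theorem gevreyBump_zero_eq (θ M : ℝ) {τ : ℝ} (hτ : τ ∈ Ioo 0 θ) :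
    gevreyBump θ M 0 τ = Real.exp (-(M / τ) - M / (θ - τ)) := by
  simp only [gevreyBump, if_pos hτ, iteratedDeriv_zero, complexBump]
  have : (-M * (τ : ℂ)⁻¹ - M * ((θ : ℂ) - τ)⁻¹) = ((-(M / τ) - M / (θ - τ) : ℝ) : ℂ) := by
    push_cast
    ring
  rw [this, ← Complex.ofReal_exp, Complex.ofReal_re]

theorem gevreyBump_zero_nonneg (θ M τ : ℝ) : 0 ≤ gevreyBump θ M 0 τ := by
  by_cases h : τ ∈ Ioo 0 θ
  · rw [gevreyBump_zero_eq θ M h]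
    positivity
  · simp only [gevreyBump, if_neg h, le_refl]

theorem intervalIntegrable_gevreyBump {θ M : ℝ} (hθ : 0 ≤ θ) (hM : 0 < M) (n : ℕ) :
    IntervalIntegrable (gevreyBump θ M n) volume 0 θ :=
  ContinuousOn.intervalIntegrable (by rw [uIcc_of_le hθ]; exact continuousOn_gevreyBump hM n)

/-- On the middle half of the interval each of the two terms in the exponent is at most `4 M / θ`.
-/
theorem integral_gevreyBump_zero_ge {θ M : ℝ} (hθ : 0 < θ) (hM : 0 < M) :
    θ / 2 * Real.exp (-(8 * M / θ)) ≤ ∫ τ in (0 : ℝ)..θ, gevreyBump θ M 0 τ := by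
  have hi := intervalIntegrable_gevreyBump hθ.le hM 0
  have h1 : ∫ τ in (θ / 4)..(3 * θ / 4), Real.exp (-(8 * M / θ)) ≤
      ∫ τ in (θ / 4)..(3 * θ / 4), gevreyBump θ M 0 τ := by
    apply intervalIntegral.integral_mono_on (by linarith) (by simp)
    · apply hi.mono_set
      rw [uIcc_of_le hθ.le, uIcc_of_le (by linarith)]
      exact Icc_subset_Icc (by linarith) (by linarith)
    · intro τ hτ
      have hτ' : τ ∈ Ioo 0 θ := ⟨by linarith [hτ.1], by linarith [hτ.2]⟩
      rw [gevreyBump_zero_eq θ M hτ', Real.exp_le_exp]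
      have a1 : M / τ ≤ 4 * M / θ := by
        rw [div_le_div_iff₀ hτ'.1 hθ]
        nlinarith [hτ.1]
      have a2 : M / (θ - τ) ≤ 4 * M / θ := by
        rw [div_le_div_iff₀ (by linarith [hτ'.2]) hθ]
        nlinarith [hτ.2]
      have : 8 * M / θ = 4 * M / θ + 4 * M / θ := by ring
      linarith
  have h2 : ∫ τ in (θ / 4)..(3 * θ / 4), gevreyBump θ M 0 τ ≤
      ∫ τ in (0 : ℝ)..θ, gevreyBump θ M 0 τ := by
    apply intervalIntegral.integral_mono_interval (by linarith) (by linarith) (by linarith)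
    · exact Eventually.of_forall fun τ => gevreyBump_zero_nonneg θ M τ
    · exact hi
  rw [intervalIntegral.integral_const, smul_eq_mul] at h1
  calc _ = (3 * θ / 4 - θ / 4) * Real.exp (-(8 * M / θ)) := by ring
    _ ≤ _ := h1.trans h2

/-- Integration by parts against the bump functions: no boundary terms. -/
theorem integral_gevreyBump_smul {E : Type*} [NormedAddCommGroup E] [NormedSpace ℝ E]
    [CompleteSpace E] {θ M : ℝ} (hθ : 0 ≤ θ) (hM : 0 < M) (n : ℕ) {z : ℝ → E}
    (hz : Continuous z) :
    ∫ τ in (0 : ℝ)..θ, gevreyBump θ M n τ • z τ =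
      -∫ τ in (0 : ℝ)..θ, gevreyBump θ M (n + 1) τ • ∫ s in (0 : ℝ)..τ, z s := by
  have hZ : ∀ τ, HasDerivAt (fun τ => ∫ s in (0 : ℝ)..τ, z s) (z τ) τ := fun τ =>
    intervalIntegral.integral_hasDerivAt_right (hz.intervalIntegrable _ _)
      (hz.stronglyMeasurableAtFilter _ _) hz.continuousAt
  have hZc : Continuous fun τ => ∫ s in (0 : ℝ)..τ, z s :=
    continuous_iff_continuousAt.2 fun τ => (hZ τ).continuousAt
  have hk := continuousOn_gevreyBump (θ := θ) hM n
  have hk' := continuousOn_gevreyBump (θ := θ) hM (n + 1)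
  have i1 : IntervalIntegrable (fun τ => gevreyBump θ M n τ • z τ) volume 0 θ :=
    ContinuousOn.intervalIntegrable (by rw [uIcc_of_le hθ]; exact hk.smul hz.continuousOn)
  have i2 : IntervalIntegrable (fun τ => gevreyBump θ M (n + 1) τ • ∫ s in (0 : ℝ)..τ, z s)
      volume 0 θ :=
    ContinuousOn.intervalIntegrable (by rw [uIcc_of_le hθ]; exact hk'.smul hZc.continuousOn)
  have h := intervalIntegral.integral_eq_sub_of_hasDerivAt_of_le hθ
    (f := fun τ => gevreyBump θ M n τ • ∫ s in (0 : ℝ)..τ, z s)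
    (f' := fun τ => gevreyBump θ M n τ • z τ + gevreyBump θ M (n + 1) τ • ∫ s in (0 : ℝ)..τ, z s)
    (hk.smul hZc.continuousOn) (fun τ hτ => (hasDerivAt_gevreyBump θ M n hτ).smul (hZ τ))
    (i1.add i2)
  rw [intervalIntegral.integral_add i1 i2, gevreyBump_zero_left, gevreyBump_zero_right] at h
  simp only [zero_smul, sub_zero] at h
  exact eq_neg_of_add_eq_zero_left h

theorem integral_gevreyBump_succ {θ M : ℝ} (hθ : 0 ≤ θ) (hM : 0 < M) (n : ℕ) :
    ∫ τ in (0 : ℝ)..θ, gevreyBump θ M (n + 1) τ = 0 := by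
  rw [intervalIntegral.integral_eq_sub_of_hasDerivAt_of_le hθ (continuousOn_gevreyBump hM n)
    (fun τ hτ => hasDerivAt_gevreyBump θ M n hτ) (intervalIntegrable_gevreyBump hθ hM (n + 1)),
    gevreyBump_zero_left, gevreyBump_zero_right, sub_zero]

/-! ### A majorant for the sideways recursion -/

theorem integral_sub_mul_neg_pow (x : ℝ) (m : ℕ) :
    ∫ y in x..0, (y - x) * (-y) ^ (2 * m) =
      (-x) ^ (2 * (m + 1)) / ((2 * m + 1) * (2 * m + 2)) := by
  have hd : ∀ y, HasDerivAt (fun y : ℝ => (y - x) * (-((-y) ^ (2 * m + 1) / (2 * m + 1))) -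
      (-y) ^ (2 * m + 2) / ((2 * m + 1) * (2 * m + 2))) ((y - x) * (-y) ^ (2 * m)) y := by
    intro y
    have h1 := ((hasDerivAt_id y).neg.pow (2 * m + 1)).div_const ((2 * m + 1 : ℝ))
    have h2 := ((hasDerivAt_id y).neg.pow (2 * m + 2)).div_const (((2 * m + 1) * (2 * m + 2) : ℝ))
    have h3 := (((hasDerivAt_id y).sub_const x).mul h1.neg).sub h2
    refine h3.congr_deriv ?_
    simp only [id_eq, Pi.neg_apply, Pi.pow_apply]
    push_cast
    field_simp
    ring
  rw [intervalIntegral.integral_eq_sub_of_hasDerivAt (fun y _ => hd y)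
    (Continuous.intervalIntegrable (by fun_prop) _ _)]
  simp [show 2 * (m + 1) = 2 * m + 2 by ring]

open scoped Nat in
-- Taylor's formula at `0` with integral remainder for `(2n)! / b² (1 + b x)^{-(2n+1)}`, whose
-- second derivative is the function multiplying `y - x`.
theorem integral_sub_mul_inv_pow {b x : ℝ} (hb : 0 < b) (hx : x ≤ 0) (hbx : 0 < 1 + b * x)
    (n : ℕ) :
    ∫ y in x..0, (y - x) * ((2 * (n + 1))! * ((1 + b * y)⁻¹) ^ (2 * (n + 1) + 1)) =
      x * (2 * n + 1)! / b - (2 * n)! / b ^ 2 +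
        (2 * n)! / b ^ 2 * ((1 + b * x)⁻¹) ^ (2 * n + 1) := by
  have hpos : ∀ y ∈ uIcc x 0, 0 < 1 + b * y := by
    intro y hy
    rw [uIcc_of_le hx] at hy
    nlinarith [hy.1]
  have hlin : ∀ y, HasDerivAt (fun y : ℝ => 1 + b * y) b y := fun y => by
    simpa using ((hasDerivAt_id y).const_mul b).const_add 1
  have f1 : ((2 * n + 1)! : ℝ) = (2 * n + 1) * (2 * n)! := by
    rw [Nat.factorial_succ]; push_cast; ring
  have f2 : ((2 * (n + 1))! : ℝ) = (2 * n + 2) * (2 * n + 1) * (2 * n)! := by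
    rw [show 2 * (n + 1) = 2 * n + 1 + 1 by ring, Nat.factorial_succ, Nat.factorial_succ]
    push_cast; ring
  have hd : ∀ y ∈ uIcc x 0, HasDerivAt (fun y : ℝ =>
      (y - x) * (-((2 * n + 1)! / b * ((1 + b * y)⁻¹) ^ (2 * n + 2))) -
      (2 * n)! / b ^ 2 * ((1 + b * y)⁻¹) ^ (2 * n + 1))
      ((y - x) * ((2 * (n + 1))! * ((1 + b * y)⁻¹) ^ (2 * (n + 1) + 1))) y := by
    intro y hy
    have h0 := (hpos y hy).ne'
    have hi := (hlin y).inv h0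
    have h1 := (hi.pow (2 * n + 2)).const_mul ((2 * n + 1)! / b : ℝ)
    have h2 := (hi.pow (2 * n + 1)).const_mul ((2 * n)! / b ^ 2 : ℝ)
    have h3 := (((hasDerivAt_id y).sub_const x).mul h1.neg).sub h2
    refine h3.congr_deriv ?_
    simp only [id_eq, Pi.neg_apply, Pi.pow_apply, Pi.inv_apply]
    push_cast
    simp only [f1, f2]
    have hc : (1 + b * y) ^ (2 * n) ≠ 0 := pow_ne_zero _ h0
    simp only [inv_pow, show 2 * (n + 1) + 1 = 2 * n + 3 by ring, pow_add]
    field_simp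
    ring
  have hc : ContinuousOn (fun y : ℝ =>
      (y - x) * ((2 * (n + 1))! * ((1 + b * y)⁻¹) ^ (2 * (n + 1) + 1))) (uIcc x 0) := by
    refine ContinuousOn.mul (by fun_prop) (continuousOn_const.mul (ContinuousOn.pow ?_ _))
    exact ContinuousOn.inv₀ (by fun_prop) fun y hy => (hpos y hy).ne'
  rw [intervalIntegral.integral_eq_sub_of_hasDerivAt hd hc.intervalIntegrable]
  simp
  ring

open scoped Nat in
-- The functions `Fₙ = D (ε b²)ⁿ (2n)! (1 + b x)^{-(2n+1)}` satisfy `ε Fₙ'' = Fₙ₊₁`, so they solve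
-- the recursion with equality for the data `Fₙ(0)` and `-Fₙ'(0)`, which dominate `|g n|` and `|g (n
-- + 1)|`. After `m` iterations `P n` is bounded by `Fₙ` plus a remainder coming from the crude
-- bound `hS`; for `n = 0` the remainder tends to `0`, so `S` does not enter the conclusion, and `F₀
-- ≤ 2 D`.
theorem abs_le_of_sideways_recursion {L ε b D S : ℝ} (hε : 0 < ε) (hb : 0 < b) (hD : 0 ≤ D)
    (hεb : ε * b ≤ 1) (hbL : b * L ≤ 1 / 2) {P : ℕ → ℝ → ℝ} {g : ℕ → ℝ}
    (hP : ∀ n, Continuous (P n))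
    (hrec : ∀ n, ∀ x ∈ Icc (-L) 0, |P n x| ≤ |g n| + -x * |g (n + 1)| +
      1 / ε * ∫ y in x..0, (y - x) * |P (n + 1) y|)
    (hg : ∀ n, |g n| ≤ D * (ε * b ^ 2 / 16) ^ n * (2 * n)!)
    (hS : ∀ n, ∀ x ∈ Icc (-L) 0, |P n x| ≤ S * (ε * b ^ 2 / 4) ^ n * (2 * n)!)
    {x : ℝ} (hx : x ∈ Icc (-L) 0) : |P 0 x| ≤ 2 * D := by
  have hpos : ∀ y ∈ Icc (-L) 0, 1 / 2 ≤ 1 + b * y := fun y hy => by nlinarith [hy.1]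
  have main : ∀ m n : ℕ, ∀ x ∈ Icc (-L) 0, |P n x| ≤
      D * (ε * b ^ 2) ^ n * ((2 * n)! * ((1 + b * x)⁻¹) ^ (2 * n + 1)) +
      S * (ε * b ^ 2 / 4) ^ (n + m) * (2 * (n + m))! / ((2 * m)! * ε ^ m) * (-x) ^ (2 * m) := by
    intro m
    induction m with
    | zero =>
      intro n x hx
      have := hpos x hx
      have h0 : 0 ≤ D * (ε * b ^ 2) ^ n * ((2 * n)! * ((1 + b * x)⁻¹) ^ (2 * n + 1)) := by
        positivity
      have := hS n x hx
      simp only [add_zero, mul_zero, Nat.factorial_zero, Nat.cast_one, pow_zero, mul_one, div_one]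
      linarith
    | succ m ih =>
      intro n x hx
      have hbx := hpos x hx
      have hx0 := hx.2
      set A : ℝ := D * (ε * b ^ 2) ^ (n + 1) with hA
      set B : ℝ := S * (ε * b ^ 2 / 4) ^ (n + 1 + m) * (2 * (n + 1 + m))! / ((2 * m)! * ε ^ m)
        with hB
      have hcont : ContinuousOn (fun y : ℝ =>
          ((2 * (n + 1))! : ℝ) * ((1 + b * y)⁻¹) ^ (2 * (n + 1) + 1)) (uIcc x 0) := by
        refine continuousOn_const.mul (ContinuousOn.pow ?_ _)
        refine ContinuousOn.inv₀ (by fun_prop) fun y hy => ?_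
        rw [uIcc_of_le hx0] at hy
        have := hpos y ⟨hx.1.trans hy.1, hy.2⟩
        linarith
      have hsub : ContinuousOn (fun y : ℝ => y - x) (uIcc x 0) := by fun_prop
      have i1 : IntervalIntegrable (fun y : ℝ => A * ((y - x) * ((2 * (n + 1))! *
          ((1 + b * y)⁻¹) ^ (2 * (n + 1) + 1)))) volume x 0 :=
        (continuousOn_const.mul (hsub.mul hcont)).intervalIntegrable
      have i2 : IntervalIntegrable (fun y : ℝ => B * ((y - x) * (-y) ^ (2 * m))) volume x 0 :=
        Continuous.intervalIntegrable (by fun_prop) _ _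
      have hint : ∫ y in x..0, (y - x) * |P (n + 1) y| ≤
          A * (x * (2 * n + 1)! / b - (2 * n)! / b ^ 2 +
            (2 * n)! / b ^ 2 * ((1 + b * x)⁻¹) ^ (2 * n + 1)) +
          B * ((-x) ^ (2 * (m + 1)) / ((2 * m + 1) * (2 * m + 2))) := by
        rw [← integral_sub_mul_neg_pow, ← integral_sub_mul_inv_pow hb hx0 (by linarith),
          ← intervalIntegral.integral_const_mul, ← intervalIntegral.integral_const_mul,
          ← intervalIntegral.integral_add i1 i2]
        have hPc := hP (n + 1)
        refine intervalIntegral.integral_mono_on hx0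
          (Continuous.intervalIntegrable (by fun_prop) _ _) (i1.add i2) fun y hy => ?_
        have := mul_le_mul_of_nonneg_left (ih (n + 1) y ⟨hx.1.trans hy.1, hy.2⟩)
          (sub_nonneg.2 hy.1)
        rw [← hA, ← hB] at this
        linarith
      have f1 : ((2 * n + 1)! : ℝ) = (2 * n + 1) * (2 * n)! := by
        rw [Nat.factorial_succ]; push_cast; ring
      have f2 : ((2 * (n + 1))! : ℝ) = (2 * n + 2) * (2 * n + 1)! := by
        rw [show 2 * (n + 1) = 2 * n + 1 + 1 by ring, Nat.factorial_succ]
        push_cast; ring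
      have f3 : ((2 * (m + 1))! : ℝ) = (2 * m + 2) * (2 * m + 1) * (2 * m)! := by
        rw [show 2 * (m + 1) = 2 * m + 1 + 1 by ring, Nat.factorial_succ, Nat.factorial_succ]
        push_cast; ring
      have e1 : |g n| ≤ D * (ε * b ^ 2) ^ n * (2 * n)! := by
        refine (hg n).trans ?_
        gcongr
        have : 0 < ε * b ^ 2 := by positivity
        linarith
      have e2 : |g (n + 1)| ≤ D * (ε * b ^ 2) ^ n * b * (2 * n + 1)! := by
        refine (hg (n + 1)).trans ?_
        -- The slack `16^{-(n+1)}` in `hg` pays for replacing `(2n + 2)!` by `(2n + 1)!`; the spare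
        -- factor `ε b` is at most `1`.
        have h16 : (2 * n + 2 : ℝ) ≤ 16 ^ (n + 1) := by
          have : ∀ k : ℕ, 2 * k + 2 ≤ 16 ^ (k + 1) := by
            intro k
            induction k with
            | zero => norm_num
            | succ k ihk => rw [pow_succ]; omega
          exact_mod_cast this n
        have key : ε * b / 16 ^ (n + 1) * (2 * n + 2) ≤ 1 := by
          rw [div_mul_eq_mul_div, div_le_one (by positivity)]
          calc ε * b * (2 * n + 2) ≤ 1 * (2 * n + 2) := by gcongr
            _ ≤ _ := by linarith
        calc D * (ε * b ^ 2 / 16) ^ (n + 1) * (2 * (n + 1))! =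
            D * (ε * b ^ 2) ^ n * b * (2 * n + 1)! * (ε * b / 16 ^ (n + 1) * (2 * n + 2)) := by
              rw [f2, div_pow]; ring
          _ ≤ D * (ε * b ^ 2) ^ n * b * (2 * n + 1)! * 1 := by gcongr
          _ = _ := by ring
      calc |P n x| ≤ |g n| + -x * |g (n + 1)| + 1 / ε * ∫ y in x..0, (y - x) * |P (n + 1) y| :=
            hrec n x hx
        _ ≤ D * (ε * b ^ 2) ^ n * (2 * n)! + -x * (D * (ε * b ^ 2) ^ n * b * (2 * n + 1)!) +
            1 / ε * (A * (x * (2 * n + 1)! / b - (2 * n)! / b ^ 2 +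
            (2 * n)! / b ^ 2 * ((1 + b * x)⁻¹) ^ (2 * n + 1)) +
            B * ((-x) ^ (2 * (m + 1)) / ((2 * m + 1) * (2 * m + 2)))) := by
              have : 0 ≤ -x := by linarith
              gcongr
        _ = _ := by
          rw [hA, hB, f3, show n + 1 + m = n + (m + 1) by ring, pow_succ ε m,
            pow_succ (ε * b ^ 2) n]
          field_simp
          ring
  have hbx := hpos x hx
  -- For `n = 0` the factorials in the remainder cancel, leaving `S (b² x² / 4)^m`, with `b² x² / 4
  -- ≤ 1 / 16`.
  have hlim : Tendsto (fun m : ℕ => D * (1 + b * x)⁻¹ + S * (b ^ 2 * x ^ 2 / 4) ^ m) atTop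
      (𝓝 (D * (1 + b * x)⁻¹ + S * 0)) := by
    refine tendsto_const_nhds.add (tendsto_const_nhds.mul
      (tendsto_pow_atTop_nhds_zero_of_lt_one (by positivity) ?_))
    have h1 : b * x ≤ 0 := by nlinarith [hx.2]
    nlinarith
  have hle : |P 0 x| ≤ D * (1 + b * x)⁻¹ + S * 0 := by
    refine ge_of_tendsto' hlim fun m => ?_
    refine (main m 0 x hx).trans (le_of_eq ?_)
    have hm : ((2 * m)! : ℝ) ≠ 0 := by exact_mod_cast Nat.factorial_ne_zero _
    simp only [zero_add, mul_zero, pow_zero, Nat.factorial_zero, Nat.cast_one, mul_one, one_mul,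
      pow_one]
    rw [pow_mul (-x), neg_sq, show b ^ 2 * x ^ 2 / 4 = b ^ 2 / 4 * x ^ 2 by ring, mul_pow,
      show ε * b ^ 2 / 4 = ε * (b ^ 2 / 4) by ring, mul_pow]
    field_simp
  refine hle.trans ?_
  rw [mul_zero, add_zero, mul_comm]
  gcongr
  rw [inv_le_comm₀ (by linarith) (by norm_num)]
  linarith

/-! ### Symmetric dissipative evolutions -/

section Dissipative

variable {H : Type*} [NormedAddCommGroup H] [NormedSpace ℝ H]

/-- A linear relation (the graph of an operator) that is symmetric for `β` and bounded above by
`-γ`. -/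
structure IsSymmetricDissipative (β : H →L[ℝ] H →L[ℝ] ℝ) (γ : ℝ) (R : H → H → Prop) : Prop where
  nonneg : 0 ≤ γ
  form_comm : ∀ f g, β f g = β g f
  form_nonneg : ∀ f, 0 ≤ β f f
  symm : ∀ {φ₁ w₁ φ₂ w₂}, R φ₁ w₁ → R φ₂ w₂ → β w₁ φ₂ = β w₂ φ₁
  dissipative : ∀ {φ w}, R φ w → β w φ ≤ -γ * β φ φ
  smul_sub : ∀ {φ₁ w₁ φ₂ w₂} (c : ℝ), R φ₁ w₁ → R φ₂ w₂ → R (c • (φ₁ - φ₂)) (c • (w₁ - w₂))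

variable {β : H →L[ℝ] H →L[ℝ] ℝ} {γ T : ℝ} {R : H → H → Prop}

/-- By symmetry `s ↦ β (z (c - s)) (z (c + s))` has zero derivative, `c` being the midpoint; compare
`s = 0` with `s = (b - a) / 2`. -/
theorem IsSymmetricDissipative.form_eq_of_hasDerivAt (hR : IsSymmetricDissipative β γ R)
    {z w : ℝ → H} (hz : ∀ τ, HasDerivAt z (w τ) τ) (hzw : ∀ τ ∈ Icc 0 T, R (z τ) (w τ))
    {a b : ℝ} (ha : 0 ≤ a) (hab : a ≤ b) (hb : b ≤ T) :
    β (z a) (z b) = β (z ((a + b) / 2)) (z ((a + b) / 2)) := by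
  set c := (a + b) / 2 with hc
  have hd : ∀ s, HasDerivAt (fun s => β (z (c - s)) (z (c + s)))
      (β (z (c - s)) (w (c + s)) + β (-w (c - s)) (z (c + s))) s := fun s => by
    have h1 : HasDerivAt (fun s => z (c - s)) (-w (c - s)) s := (hz (c - s)).comp_const_sub c s
    have h2 : HasDerivAt (fun s => z (c + s)) (w (c + s)) s := (hz (c + s)).comp_const_add c s
    exact β.hasDerivAt_of_bilinear (fun _ => h1) (fun _ => h2)
  have key := constant_of_has_deriv_right_zero (a := 0) (b := (b - a) / 2)
    (f := fun s => β (z (c - s)) (z (c + s)))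
    (fun s _ => (hd s).continuousAt.continuousWithinAt) (fun s hs => by
      have h := (hd s).hasDerivWithinAt (s := Ici s)
      have e : β (z (c - s)) (w (c + s)) + β (-w (c - s)) (z (c + s)) = 0 := by
        have := hR.symm (hzw (c - s) ⟨by linarith [hs.2], by linarith [hs.1]⟩)
          (hzw (c + s) ⟨by linarith [hs.1], by linarith [hs.2]⟩)
        rw [map_neg, neg_apply, this, hR.form_comm]
        ring
      rwa [e] at h) ((b - a) / 2) ⟨by linarith, le_rfl⟩
  have e1 : c - (b - a) / 2 = a := by rw [hc]; ring
  have e2 : c + (b - a) / 2 = b := by rw [hc]; ring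
  simpa [e1, e2] using key

theorem IsSymmetricDissipative.form_le_of_hasDerivAt (hR : IsSymmetricDissipative β γ R)
    {z w : ℝ → H} (hz : ∀ τ, HasDerivAt z (w τ) τ) (hzw : ∀ τ ∈ Icc 0 T, R (z τ) (w τ))
    {a b : ℝ} (ha : 0 ≤ a) (hab : a ≤ b) (hb : b ≤ T) :
    β (z b) (z b) ≤ Real.exp (-(2 * γ * (b - a))) * β (z a) (z a) := by
  have hd : ∀ s, HasDerivAt (fun s => Real.exp (2 * γ * s) * β (z s) (z s))
      (Real.exp (2 * γ * s) * (2 * γ) * β (z s) (z s) +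
        Real.exp (2 * γ * s) * (β (z s) (w s) + β (w s) (z s))) s := fun s => by
    have h1 : HasDerivAt (fun s => Real.exp (2 * γ * s)) (Real.exp (2 * γ * s) * (2 * γ)) s := by
      simpa using ((hasDerivAt_id s).const_mul (2 * γ)).exp
    exact h1.mul (β.hasDerivAt_of_bilinear (fun _ => hz s) (fun _ => hz s))
  have hanti : AntitoneOn (fun s => Real.exp (2 * γ * s) * β (z s) (z s)) (Icc a b) := by
    apply antitoneOn_of_deriv_nonpos (convex_Icc a b)
    · exact fun s _ => (hd s).continuousAt.continuousWithinAt
    · exact fun s _ => (hd s).differentiableAt.differentiableWithinAt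
    · intro s hs
      rw [interior_Icc] at hs
      rw [(hd s).deriv, hR.form_comm (z s) (w s)]
      have := hR.dissipative (hzw s ⟨by linarith [hs.1], by linarith [hs.2]⟩)
      have he := Real.exp_pos (2 * γ * s)
      nlinarith
  have h := hanti (left_mem_Icc.2 hab) (right_mem_Icc.2 hab) hab
  simp only at h
  have e : Real.exp (-(2 * γ * (b - a))) = Real.exp (2 * γ * a) * Real.exp (-(2 * γ * b)) := by
    rw [← Real.exp_add]; congr 1; ring
  calc β (z b) (z b) = Real.exp (2 * γ * b) * β (z b) (z b) * Real.exp (-(2 * γ * b)) := by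
        rw [Real.exp_neg]; field_simp
    _ ≤ Real.exp (2 * γ * a) * β (z a) (z a) * Real.exp (-(2 * γ * b)) := by gcongr
    _ = _ := by rw [e]; ring

/-- Mild solutions of the evolution equation given by a linear relation. -/
structure IsMildOrbit (R : H → H → Prop) (T : ℝ) (z : ℝ → H) : Prop where
  continuous : Continuous z
  mild : ∀ τ ∈ Icc 0 T, R (∫ s in (0 : ℝ)..τ, z s) (z τ - z 0)

variable [CompleteSpace H] {z : ℝ → H}

/-- The Steklov average of a mild orbit is a strong orbit. -/
theorem IsMildOrbit.steklov (hR : IsSymmetricDissipative β γ R) (hz : IsMildOrbit R T z) {h : ℝ}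
    (hh : 0 ≤ h) :
    (∀ τ, HasDerivAt (fun τ => h⁻¹ • ∫ s in τ..τ + h, z s) (h⁻¹ • (z (τ + h) - z τ)) τ) ∧
      ∀ τ ∈ Icc 0 (T - h), R (h⁻¹ • ∫ s in τ..τ + h, z s) (h⁻¹ • (z (τ + h) - z τ)) := by
  have hc := hz.continuous
  have e : ∀ τ, ∫ s in τ..τ + h, z s = (∫ s in (0 : ℝ)..τ + h, z s) - ∫ s in (0 : ℝ)..τ, z s :=
    fun τ => (intervalIntegral.integral_interval_sub_left (hc.intervalIntegrable _ _)
      (hc.intervalIntegrable _ _)).symm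
  constructor
  · intro τ
    simp_rw [e]
    have hZ : ∀ τ, HasDerivAt (fun τ => ∫ s in (0 : ℝ)..τ, z s) (z τ) τ := fun τ =>
      intervalIntegral.integral_hasDerivAt_right (hc.intervalIntegrable _ _)
        (hc.stronglyMeasurableAtFilter _ _) hc.continuousAt
    have h1 : HasDerivAt (fun τ => ∫ s in (0 : ℝ)..τ + h, z s) (z (τ + h)) τ :=
      (hZ (τ + h)).comp_add_const τ h
    exact (h1.sub (hZ τ)).const_smul h⁻¹
  · intro τ hτ
    rw [e]
    -- The mild equations at `τ + h` and `τ` are subtracted, so that `z 0` cancels.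
    have := hR.smul_sub h⁻¹ (hz.mild (τ + h) ⟨by linarith [hτ.1], by linarith [hτ.2]⟩)
      (hz.mild τ ⟨hτ.1, by linarith [hτ.2]⟩)
    rwa [sub_sub_sub_cancel_right] at this

theorem tendsto_steklov (hc : Continuous z) (τ : ℝ) :
    Tendsto (fun h : ℝ => h⁻¹ • ∫ s in τ..τ + h, z s) (𝓝[>] 0) (𝓝 (z τ)) := by
  have hZ : HasDerivAt (fun x => ∫ s in τ..x, z s) (z τ) τ :=
    intervalIntegral.integral_hasDerivAt_right (hc.intervalIntegrable _ _)
      (hc.stronglyMeasurableAtFilter _ _) hc.continuousAt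
  have := hZ.tendsto_slope_zero_right
  simpa using this

theorem tendsto_form_steklov (β : H →L[ℝ] H →L[ℝ] ℝ) (hc : Continuous z) (a b : ℝ) :
    Tendsto (fun h : ℝ => β (h⁻¹ • ∫ s in a..a + h, z s) (h⁻¹ • ∫ s in b..b + h, z s))
      (𝓝[>] 0) (𝓝 (β (z a) (z b))) := by
  have hβ : Continuous fun p : H × H => β p.1 p.2 := by fun_prop
  exact (hβ.tendsto (z a, z b)).comp ((tendsto_steklov hc a).prodMk_nhds (tendsto_steklov hc b))

/-- For strong orbits `β (z a) (z b)` is the energy at the midpoint of `a` and `b`, and the energy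
is nonincreasing. Steklov averages transfer this to mild orbits; they look ahead by `h`, whence `b <
T`. -/
theorem IsMildOrbit.form_self_le (hR : IsSymmetricDissipative β γ R) (hz : IsMildOrbit R T z)
    {a b : ℝ} (ha : 0 ≤ a) (hab : a ≤ b) (hb : b < T) :
    β (z b) (z b) ≤ β (z a) (z b) := by
  refine le_of_tendsto_of_tendsto (tendsto_form_steklov β hz.continuous b b)
    (tendsto_form_steklov β hz.continuous a b) ?_
  filter_upwards [Ioo_mem_nhdsGT (sub_pos.2 hb)] with h hh
  obtain ⟨h1, h2⟩ := hz.steklov hR hh.1.le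
  have hb' : b ≤ T - h := by linarith [hh.2]
  have e1 := hR.form_eq_of_hasDerivAt h1 h2 ha hab hb'
  have e2 := hR.form_le_of_hasDerivAt h1 h2 (a := (a + b) / 2) (by linarith) (by linarith) hb'
  rw [e1]
  refine e2.trans (mul_le_of_le_one_left (hR.form_nonneg _) (Real.exp_le_one_iff.2 ?_))
  have : 0 ≤ b - (a + b) / 2 := by linarith
  have := hR.nonneg
  simp only [Left.neg_nonpos_iff]
  positivity

theorem IsMildOrbit.form_le (hR : IsSymmetricDissipative β γ R) (hz : IsMildOrbit R T z)
    {a b : ℝ} (ha : 0 ≤ a) (hab : a < b) (hb : b ≤ T) :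
    β (z b) (z b) ≤ Real.exp (-(2 * γ * (b - a))) * β (z a) (z a) := by
  have hlt : ∀ b' ∈ Ioo a b,
      β (z b') (z b') ≤ Real.exp (-(2 * γ * (b' - a))) * β (z a) (z a) := by
    intro b' hb'
    refine le_of_tendsto_of_tendsto (tendsto_form_steklov β hz.continuous b' b')
      ((tendsto_form_steklov β hz.continuous a a).const_mul _) ?_
    filter_upwards [Ioo_mem_nhdsGT (sub_pos.2 (hb'.2.trans_le hb))] with h hh
    obtain ⟨h1, h2⟩ := hz.steklov hR hh.1.le
    exact hR.form_le_of_hasDerivAt h1 h2 ha hb'.1.le (by linarith [hh.2])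
  -- The case `b = T`, out of reach of the averages, follows by letting the endpoint increase to
  -- `b`.
  have hc := hz.continuous
  have hl : Continuous fun s => β (z s) (z s) := by fun_prop
  have hr : Continuous fun s => Real.exp (-(2 * γ * (s - a))) * β (z a) (z a) := by fun_prop
  refine le_of_tendsto_of_tendsto (hl.continuousWithinAt (s := Iio b))
    (hr.continuousWithinAt (s := Iio b)) ?_
  filter_upwards [Ioo_mem_nhdsLT hab] with s hs using hlt s hs

end Dissipative

/-! ### The space `H¹` of an interval -/

/-- The fundamental theorem of calculus for a product of two primitives. -/
theorem integral_deriv_mul_of_eq_primitive {a b : ℝ} (hab : a ≤ b) {f f' g g' : ℝ → ℝ}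
    (hf' : IntervalIntegrable f' volume a b) (hg' : IntervalIntegrable g' volume a b)
    (hf : ∀ x ∈ Icc a b, f x = f a + ∫ y in a..x, f' y)
    (hg : ∀ x ∈ Icc a b, g x = g a + ∫ y in a..x, g' y) :
    ∫ x in a..b, (f' x * g x + f x * g' x) = f b * g b - f a * g a := by
  have ac : ∀ {h' : ℝ → ℝ} (c : ℝ), IntervalIntegrable h' volume a b →
      AbsolutelyContinuousOnInterval (fun x => c + ∫ y in a..x, h' y) a b := fun c hh =>
    (contDiffOn_const (n := 1) (c := c)).absolutelyContinuousOnInterval.add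
      (hh.absolutelyContinuousOnInterval_intervalIntegral (c := a) (by simp))
  have key := (ac (f a) hf').integral_deriv_mul_eq_sub (ac (g a) hg')
  have e : ∀ᵐ x, x ∈ uIoc a b → deriv (fun x => f a + ∫ y in a..x, f' y) x = f' x ∧
      deriv (fun x => g a + ∫ y in a..x, g' y) x = g' x := by
    filter_upwards [hf'.ae_hasDerivAt_integral, hg'.ae_hasDerivAt_integral] with x h1 h2 hx
    exact ⟨((h1 (uIoc_subset_uIcc hx) a (by simp)).const_add _).deriv,
      ((h2 (uIoc_subset_uIcc hx) a (by simp)).const_add _).deriv⟩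
  rw [← hf b (right_mem_Icc.2 hab), ← hg b (right_mem_Icc.2 hab)] at key
  simp only [intervalIntegral.integral_same, add_zero] at key
  rw [← key]
  apply intervalIntegral.integral_congr_ae
  filter_upwards [e] with x hx hxab
  obtain ⟨h1, h2⟩ := hx hxab
  have hx' : x ∈ Icc a b := by
    rw [uIoc_of_le hab] at hxab
    exact Ioc_subset_Icc_self hxab
  rw [h1, h2, hf x hx', hg x hx']

theorem memLp_restrict_Ioo_of_continuousOn {a b : ℝ} {f : ℝ → ℝ} (hf : ContinuousOn f (Icc a b))
    (p : ℝ≥0∞) : MemLp f p (volume.restrict (Ioo a b)) := by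
  obtain ⟨C, hC⟩ := isCompact_Icc.exists_bound_of_continuousOn hf
  refine MemLp.of_bound
    ((hf.mono Ioo_subset_Icc_self).aestronglyMeasurable measurableSet_Ioo) C ?_
  filter_upwards [ae_restrict_mem measurableSet_Ioo] with x hx
  exact hC x (Ioo_subset_Icc_self hx)

theorem MeasureTheory.MemLp.intervalIntegrable_of_Ioo {a b : ℝ} (hab : a ≤ b) {f : ℝ → ℝ}
    (hf : MemLp f 2 (volume.restrict (Ioo a b))) : IntervalIntegrable f volume a b := by
  rw [intervalIntegrable_iff_integrableOn_Ioo_of_le hab]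
  exact hf.integrable (by norm_num)

theorem MeasureTheory.MemLp.intervalIntegrable_mul {a b : ℝ} (hab : a ≤ b) {f g : ℝ → ℝ}
    (hf : MemLp f 2 (volume.restrict (Ioo a b))) (hg : MemLp g 2 (volume.restrict (Ioo a b))) :
    IntervalIntegrable (fun x => f x * g x) volume a b := by
  rw [intervalIntegrable_iff_integrableOn_Ioo_of_le hab]
  exact hf.integrable_mul hg

namespace IsH1

variable {L ε : ℝ} {u u' v v' : ℝ → ℝ}

theorem intervalIntegrable (hL : 0 ≤ L) (hu : IsH1 L u u') :
    IntervalIntegrable u' volume (-L) 0 :=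
  hu.memLp.intervalIntegrable_of_Ioo (by linarith)

theorem continuousOn (hL : 0 ≤ L) (hu : IsH1 L u u') : ContinuousOn u (Icc (-L) 0) := by
  have hab : -L ≤ 0 := by linarith
  have h := intervalIntegral.continuousOn_primitive_interval' (hu.intervalIntegrable hL)
    (a := -L) (by simp)
  rw [uIcc_of_le hab] at h
  exact (continuousOn_const.add h).congr hu.eq_integral

theorem memLp_self (hL : 0 ≤ L) (hu : IsH1 L u u') :
    MemLp u 2 (volume.restrict (Ioo (-L) 0)) :=
  memLp_restrict_Ioo_of_continuousOn (hu.continuousOn hL) 2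

theorem eq_add_integral (hL : 0 ≤ L) (hu : IsH1 L u u') {x y : ℝ} (hx : x ∈ Icc (-L) 0)
    (hy : y ∈ Icc x 0) : u y = u x + ∫ s in x..y, u' s := by
  have hi := hu.intervalIntegrable hL
  have hx0 : -L ≤ 0 := by linarith
  have hy' : y ∈ Icc (-L) 0 := ⟨hx.1.trans hy.1, hy.2⟩
  have i1 : IntervalIntegrable u' volume (-L) x := hi.mono_set (by
    rw [uIcc_of_le hx0, uIcc_of_le hx.1]; exact Icc_subset_Icc le_rfl hx.2)
  have i2 : IntervalIntegrable u' volume x y := hi.mono_set (by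
    rw [uIcc_of_le hx0, uIcc_of_le hy.1]; exact Icc_subset_Icc hx.1 hy.2)
  rw [hu.eq_integral y hy', hu.eq_integral x hx,
    ← intervalIntegral.integral_add_adjacent_intervals i1 i2, add_assoc]

theorem integral_deriv_mul (hL : 0 ≤ L) (hu : IsH1 L u u') (hv : IsH1 L v v') {x y : ℝ}
    (hx : x ∈ Icc (-L) 0) (hy : y ∈ Icc x 0) :
    ∫ s in x..y, (u' s * v s + u s * v' s) = u y * v y - u x * v x := by
  have hsub : uIcc x y ⊆ uIcc (-L) 0 := by
    rw [uIcc_of_le (by linarith : -L ≤ 0), uIcc_of_le hy.1]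
    exact Icc_subset_Icc hx.1 hy.2
  exact integral_deriv_mul_of_eq_primitive hy.1 ((hu.intervalIntegrable hL).mono_set hsub)
    ((hv.intervalIntegrable hL).mono_set hsub)
    (fun s hs => hu.eq_add_integral hL hx ⟨hs.1, hs.2.trans hy.2⟩)
    (fun s hs => hv.eq_add_integral hL hx ⟨hs.1, hs.2.trans hy.2⟩)

theorem of_hasDerivAt (hu : ∀ x, HasDerivAt u (u' x) x) (hc : Continuous u') : IsH1 L u u' where
  memLp := memLp_restrict_Ioo_of_continuousOn hc.continuousOn 2
  eq_integral x _ := by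
    rw [intervalIntegral.integral_eq_sub_of_hasDerivAt (fun y _ => hu y)
      (hc.intervalIntegrable _ _)]
    ring

theorem exp_div (L ε : ℝ) :
    IsH1 L (fun x => Real.exp (x / ε)) (fun x => Real.exp (x / ε) * (1 / ε)) := by
  refine of_hasDerivAt (fun x => ?_) (by fun_prop)
  simpa using ((hasDerivAt_id x).div_const ε).exp

theorem continuous_mul_memLp {a b : ℝ} {f g : ℝ → ℝ} (hf : ContinuousOn f (Icc a b))
    (hg : MemLp g 2 (volume.restrict (Ioo a b))) :
    MemLp (fun x => f x * g x) 2 (volume.restrict (Ioo a b)) :=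
  hg.mul (memLp_restrict_Ioo_of_continuousOn hf ∞)

theorem mul (hL : 0 ≤ L) (hu : IsH1 L u u') (hv : IsH1 L v v') :
    IsH1 L (fun x => u x * v x) (fun x => u' x * v x + u x * v' x) where
  memLp := by
    have h1 := continuous_mul_memLp (hv.continuousOn hL) hu.memLp
    have h2 := continuous_mul_memLp (hu.continuousOn hL) hv.memLp
    refine MemLp.add ?_ h2
    simpa only [mul_comm] using h1
  eq_integral x hx := by
    rw [integral_deriv_mul hL hu hv (left_mem_Icc.2 (by linarith)) hx]
    ring

theorem exp_mul (hL : 0 ≤ L) (hu : IsH1 L u u') :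
    IsH1 L (fun x => Real.exp (x / ε) * u x) (fun x => Real.exp (x / ε) * (u' x + u x / ε)) := by
  have h := (exp_div L ε).mul hL hu
  have e : (fun x => Real.exp (x / ε) * (u' x + u x / ε)) =
      fun x => Real.exp (x / ε) * (1 / ε) * u x + Real.exp (x / ε) * u' x := by
    funext x; ring
  rwa [e]

theorem smul_sub (c : ℝ) (hL : 0 ≤ L) (hu : IsH1 L u u') (hv : IsH1 L v v') :
    IsH1 L (fun x => c * (u x - v x)) (fun x => c * (u' x - v' x)) where
  memLp := (hu.memLp.sub hv.memLp).const_mul c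
  eq_integral x hx := by
    have hsub : uIcc (-L) x ⊆ uIcc (-L) 0 := by
      rw [uIcc_of_le (by linarith : -L ≤ 0), uIcc_of_le hx.1]
      exact Icc_subset_Icc le_rfl hx.2
    rw [intervalIntegral.integral_const_mul,
      intervalIntegral.integral_sub ((hu.intervalIntegrable hL).mono_set hsub)
        ((hv.intervalIntegrable hL).mono_set hsub), hu.eq_integral x hx, hv.eq_integral x hx]
    ring

/-- The truncated exponential `ε (e^{y/ε} - e^{x/ε})₊`. -/
theorem truncated_exp (hε : 0 < ε) {x : ℝ} (hx : x ∈ Icc (-L) 0) :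
    IsH1 L (fun y => ε * max 0 (Real.exp (y / ε) - Real.exp (x / ε)))
      ((Ioi x).indicator fun y => Real.exp (y / ε)) where
  memLp := (memLp_restrict_Ioo_of_continuousOn (by fun_prop) 2).indicator measurableSet_Ioi
  eq_integral y hy := by
    have hmono : ∀ s t : ℝ, s ≤ t → Real.exp (s / ε) ≤ Real.exp (t / ε) := fun s t h => by gcongr
    have hint : ∀ s t : ℝ, IntervalIntegrable ((Ioi x).indicator fun y => Real.exp (y / ε))
        volume s t := fun s t => by
      rw [intervalIntegrable_iff]
      exact IntegrableOn.indicator (intervalIntegrable_iff.1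
        (Continuous.intervalIntegrable (by fun_prop) s t)) measurableSet_Ioi
    have hzero : ∀ s t : ℝ, s ≤ t → t ≤ x →
        ∫ r in s..t, ((Ioi x).indicator fun y => Real.exp (y / ε)) r = 0 := fun s t hst ht => by
      rw [intervalIntegral.integral_of_le hst]
      refine setIntegral_eq_zero_of_forall_eq_zero fun r hr => ?_
      exact indicator_of_notMem (fun h => absurd (hr.2.trans ht) (not_le.2 h)) _
    have h0 : max 0 (Real.exp (-L / ε) - Real.exp (x / ε)) = 0 :=
      max_eq_left (by linarith [hmono _ _ hx.1])
    rw [h0]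
    rcases le_total y x with h | h
    · rw [hzero _ _ hy.1 h, max_eq_left (by linarith [hmono _ _ h])]
      ring
    · rw [← intervalIntegral.integral_add_adjacent_intervals (hint (-L) x) (hint x y),
        hzero _ _ hx.1 le_rfl, max_eq_right (by linarith [hmono _ _ h])]
      have : ∫ r in x..y, ((Ioi x).indicator fun y => Real.exp (y / ε)) r =
          ∫ r in x..y, Real.exp (r / ε) := by
        rw [intervalIntegral.integral_of_le h, intervalIntegral.integral_of_le h]
        exact setIntegral_congr_fun measurableSet_Ioc fun r hr => indicator_of_mem hr.1 _
      rw [this, intervalIntegral.integral_eq_sub_of_hasDerivAt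
        (f := fun r => ε * Real.exp (r / ε)) (fun r _ => ?_)
        (Continuous.intervalIntegrable (by fun_prop) _ _)]
      · ring
      · have := (((hasDerivAt_id r).div_const ε).exp).const_mul ε
        refine this.congr_deriv ?_
        simp only [id_eq]
        field_simp

end IsH1

/-! ### The state space and the graph of the adjoint operator -/

instance isFiniteMeasure_bulkBoundaryMeasure (ε L : ℝ) :
    IsFiniteMeasure (bulkBoundaryMeasure ε L) := by
  have : IsFiniteMeasure (ENNReal.ofReal ε • (Measure.dirac (-L) + Measure.dirac (0 : ℝ))) :=
    Measure.smul_finite _ ENNReal.ofReal_ne_top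
  unfold bulkBoundaryMeasure
  infer_instance

theorem ae_bulkBoundaryMeasure_iff {ε : ℝ} (hε : 0 < ε) (L : ℝ) {p : ℝ → Prop} :
    (∀ᵐ x ∂bulkBoundaryMeasure ε L, p x) ↔
      (∀ᵐ x ∂volume.restrict (Ioo (-L) 0), p x) ∧ p (-L) ∧ p 0 := by
  rw [bulkBoundaryMeasure, ae_add_measure_iff,
    Measure.ae_ennreal_smul_measure_iff (ENNReal.ofReal_pos.2 hε).ne', ae_add_measure_iff,
    ae_dirac_eq, ae_dirac_eq]
  rfl

theorem ae_mem_Icc_bulkBoundaryMeasure {ε L : ℝ} (hε : 0 < ε) (hL : 0 ≤ L) :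
    ∀ᵐ x ∂bulkBoundaryMeasure ε L, x ∈ Icc (-L) 0 := by
  rw [ae_bulkBoundaryMeasure_iff hε]
  refine ⟨?_, ⟨le_rfl, by linarith⟩, ⟨by linarith, le_rfl⟩⟩
  filter_upwards [ae_restrict_mem measurableSet_Ioo] with x hx using Ioo_subset_Icc_self hx

theorem restrict_le_bulkBoundaryMeasure (ε L : ℝ) :
    volume.restrict (Ioo (-L) 0) ≤ bulkBoundaryMeasure ε L :=
  Measure.le_add_right le_rfl

theorem integrable_bulkBoundaryMeasure {ε L : ℝ} {f : ℝ → ℝ} (hL : 0 ≤ L)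
    (hf : IntervalIntegrable f volume (-L) 0) : Integrable f (bulkBoundaryMeasure ε L) := by
  rw [intervalIntegrable_iff_integrableOn_Ioo_of_le (by linarith)] at hf
  refine Integrable.add_measure hf (Integrable.smul_measure ?_ ENNReal.ofReal_ne_top)
  exact (integrable_dirac (by simp)).add_measure (integrable_dirac (by simp))

theorem integral_bulkBoundaryMeasure {ε L : ℝ} {f : ℝ → ℝ} (hε : 0 ≤ ε) (hL : 0 ≤ L)
    (hf : IntervalIntegrable f volume (-L) 0) :
    ∫ x, f x ∂bulkBoundaryMeasure ε L = (∫ x in (-L)..0, f x) + ε * (f (-L) + f 0) := by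
  have h1 := (intervalIntegrable_iff_integrableOn_Ioo_of_le (by linarith)).1 hf
  have h2 : ∀ a : ℝ, Integrable f (Measure.dirac a) := fun a => integrable_dirac (by simp)
  rw [bulkBoundaryMeasure, integral_add_measure h1
    (((h2 _).add_measure (h2 _)).smul_measure ENNReal.ofReal_ne_top), integral_smul_measure,
    integral_add_measure (h2 _) (h2 _), integral_dirac, integral_dirac,
    ENNReal.toReal_ofReal hε, smul_eq_mul, intervalIntegral.integral_of_le (by linarith),
    integral_Ioc_eq_integral_Ioo]

theorem StateSpace.memLp_restrict {ε L : ℝ} (f : StateSpace ε L) :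
    MemLp f 2 (volume.restrict (Ioo (-L) 0)) :=
  (Lp.memLp f).mono_measure (restrict_le_bulkBoundaryMeasure ε L)

/-- The weight `e^{x/ε}`, truncated outside of `[-L, 0]`. -/
noncomputable def expWeight (ε L : ℝ) : Lp ℝ ∞ (bulkBoundaryMeasure ε L) :=
  MemLp.toLp (fun x => min 1 (Real.exp (x / ε)))
    (memLp_top_of_bound (by fun_prop) 1 (Eventually.of_forall fun x => by
      rw [Real.norm_of_nonneg (by positivity)]
      exact min_le_left _ _))

/-- Multiplication by `e^{x/ε}`. -/
noncomputable def expMul (ε L : ℝ) : StateSpace ε L →L[ℝ] StateSpace ε L :=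
  (ContinuousLinearMap.mul ℝ ℝ).holderL (bulkBoundaryMeasure ε L) ∞ 2 2 (expWeight ε L)

theorem expMul_ae {ε L : ℝ} (hε : 0 < ε) (hL : 0 ≤ L) (f : StateSpace ε L) :
    expMul ε L f =ᵐ[bulkBoundaryMeasure ε L] fun x => Real.exp (x / ε) * f x := by
  have h1 := (ContinuousLinearMap.mul ℝ ℝ).coeFn_holder (r := 2) (expWeight ε L) f
  have h2 : expWeight ε L =ᵐ[bulkBoundaryMeasure ε L] _ := MemLp.coeFn_toLp _
  filter_upwards [h1, h2, ae_mem_Icc_bulkBoundaryMeasure hε hL] with x h1 h2 hx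
  change ((ContinuousLinearMap.mul ℝ ℝ).holder 2 (expWeight ε L) f) x = _
  have hle : Real.exp (x / ε) ≤ 1 :=
    Real.exp_le_one_iff.2 (div_nonpos_of_nonpos_of_nonneg hx.2 hε.le)
  rw [h1, h2, min_eq_right hle, ContinuousLinearMap.mul_apply']

/-- The inner product of `L²(e^{x/ε} μ)`. -/
noncomputable def weightedForm (ε L : ℝ) : StateSpace ε L →L[ℝ] StateSpace ε L →L[ℝ] ℝ :=
  ((ContinuousLinearMap.mul ℝ ℝ).lpPairing (bulkBoundaryMeasure ε L) 2 2).comp (expMul ε L)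

theorem weightedForm_apply {ε L : ℝ} (hε : 0 < ε) (hL : 0 ≤ L) (f g : StateSpace ε L) :
    weightedForm ε L f g = ∫ x, Real.exp (x / ε) * (f x * g x) ∂bulkBoundaryMeasure ε L := by
  rw [weightedForm, ContinuousLinearMap.comp_apply, ContinuousLinearMap.lpPairing_eq_integral]
  apply integral_congr_ae
  filter_upwards [expMul_ae hε hL f] with x hx
  rw [hx, ContinuousLinearMap.mul_apply', mul_assoc]

theorem weightedForm_comm {ε L : ℝ} (hε : 0 < ε) (hL : 0 ≤ L) (f g : StateSpace ε L) :
    weightedForm ε L f g = weightedForm ε L g f := by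
  rw [weightedForm_apply hε hL, weightedForm_apply hε hL]
  simp only [mul_comm]

theorem weightedForm_self_nonneg {ε L : ℝ} (hε : 0 < ε) (hL : 0 ≤ L) (f : StateSpace ε L) :
    0 ≤ weightedForm ε L f f := by
  rw [weightedForm_apply hε hL]
  exact integral_nonneg fun x => mul_nonneg (Real.exp_pos _).le (mul_self_nonneg _)

/-- The derivative of `e^{x/ε} v` is `e^{x/ε} (v' + v/ε)`, and diffusion and drift combine into `ε
(u' + u/ε)` against it. The outcome is symmetric in `u` and `v`, which is the reason for the weight.
-/
theorem formA_exp_mul {ε L : ℝ} (hε : 0 < ε) (hL : 0 ≤ L) {u u' v v' : ℝ → ℝ} (hu : IsH1 L u u')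
    (hv : IsH1 L v v') :
    formA ε L (fun x => Real.exp (x / ε) * v x) (fun x => Real.exp (x / ε) * (v' x + v x / ε)) u u' =
      ε * (∫ x in (-L)..0, Real.exp (x / ε) * ((v' x + v x / ε) * (u' x + u x / ε))) +
        Real.exp (-L / ε) * v (-L) * u (-L) := by
  have hab : -L ≤ 0 := by linarith
  have hm := (hv.exp_mul (ε := ε) hL).memLp
  rw [formA, ← intervalIntegral.integral_const_mul, ← intervalIntegral.integral_add
    ((hm.intervalIntegrable_mul hab hu.memLp).const_mul ε)
    (hm.intervalIntegrable_mul hab (hu.memLp_self hL)), ← intervalIntegral.integral_const_mul]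
  congr 1
  apply intervalIntegral.integral_congr
  intro x _
  simp only
  field_simp

theorem IsAdjointValue.symm {ε L : ℝ} (hε : 0 < ε) (hL : 0 ≤ L) {φ₁ w₁ φ₂ w₂ : StateSpace ε L}
    (h₁ : IsAdjointValue ε L φ₁ w₁) (h₂ : IsAdjointValue ε L φ₂ w₂) :
    weightedForm ε L w₁ φ₂ = weightedForm ε L w₂ φ₁ := by
  have key : ∀ {φ₁ w₁ φ₂ : StateSpace ε L} {u₁ u₁' u₂ u₂' : ℝ → ℝ}, IsH1 L u₁ u₁' →
      IsH1 L u₂ u₂' → φ₂ =ᵐ[bulkBoundaryMeasure ε L] u₂ →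
      (∀ v v' : ℝ → ℝ, IsH1 L v v' →
        formA ε L v v' u₁ u₁' = -∫ x, w₁ x * v x ∂(bulkBoundaryMeasure ε L)) →
      weightedForm ε L w₁ φ₂ =
        -(ε * (∫ x in (-L)..0, Real.exp (x / ε) * ((u₂' x + u₂ x / ε) * (u₁' x + u₁ x / ε))) +
        Real.exp (-L / ε) * u₂ (-L) * u₁ (-L)) := by
    intro φ₁ w₁ φ₂ u₁ u₁' u₂ u₂' hu₁ hu₂ he₂ hf₁
    rw [← formA_exp_mul hε hL hu₁ hu₂, hf₁ _ _ (hu₂.exp_mul hL), neg_neg,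
      weightedForm_apply hε hL]
    apply integral_congr_ae
    filter_upwards [he₂] with x hx
    rw [hx]
    ring
  obtain ⟨u₁, u₁', hu₁, he₁, hf₁⟩ := h₁
  obtain ⟨u₂, u₂', hu₂, he₂, hf₂⟩ := h₂
  rw [key (φ₁ := φ₁) hu₁ hu₂ he₂ hf₁, key (φ₁ := φ₂) hu₂ hu₁ he₁ hf₂]
  simp only [mul_comm, mul_left_comm]

/-- With `p = u' + u/ε`, one has `(e^{x/ε} u²)' = e^{x/ε} (2 u p - u²/ε)`, and Young's inequality
bounds this by `e^{x/ε} (2 ε p² - u²/(2ε))`. Half of the integrated inequality gives the rate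
`1/(4ε)`; the boundary terms suffice for the two atoms. -/
theorem IsAdjointValue.dissipative {ε L : ℝ} (hε : 0 < ε) (hL : 0 ≤ L) {φ w : StateSpace ε L}
    (h : IsAdjointValue ε L φ w) :
    weightedForm ε L w φ ≤ -(1 / (4 * ε)) * weightedForm ε L φ φ := by
  obtain ⟨u, u', hu, he, hf⟩ := h
  have hab : -L ≤ 0 := by linarith
  have hE := hu.exp_mul (ε := ε) hL
  have hEu := hE.memLp_self hL
  have e1 : weightedForm ε L w φ =
      -(ε * (∫ x in (-L)..0, Real.exp (x / ε) * ((u' x + u x / ε) * (u' x + u x / ε))) +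
        Real.exp (-L / ε) * u (-L) * u (-L)) := by
    rw [← formA_exp_mul hε hL hu hu, hf _ _ hE, neg_neg, weightedForm_apply hε hL]
    apply integral_congr_ae
    filter_upwards [he] with x hx
    rw [hx]
    ring
  have iuu : IntervalIntegrable (fun x => Real.exp (x / ε) * (u x * u x)) volume (-L) 0 := by
    simpa only [mul_assoc] using hEu.intervalIntegrable_mul hab (hu.memLp_self hL)
  have ipp : IntervalIntegrable
      (fun x => Real.exp (x / ε) * ((u' x + u x / ε) * (u' x + u x / ε))) volume (-L) 0 := by
    have hp : MemLp (fun x => u' x + u x / ε) 2 (volume.restrict (Ioo (-L) 0)) := by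
      simpa only [div_eq_mul_inv, Pi.add_def] using hu.memLp.add ((hu.memLp_self hL).mul_const ε⁻¹)
    simpa only [mul_assoc] using hE.memLp.intervalIntegrable_mul hab hp
  have e2 : weightedForm ε L φ φ = (∫ x in (-L)..0, Real.exp (x / ε) * (u x * u x)) +
      ε * (Real.exp (-L / ε) * (u (-L) * u (-L)) + u 0 * u 0) := by
    have : weightedForm ε L φ φ =
        ∫ x, Real.exp (x / ε) * (u x * u x) ∂bulkBoundaryMeasure ε L := by
      rw [weightedForm_apply hε hL]
      apply integral_congr_ae
      filter_upwards [he] with x hx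
      rw [hx]
    rw [this, integral_bulkBoundaryMeasure hε.le hL iuu]
    simp
  have hftc := hE.integral_deriv_mul hL hu (x := -L) (y := 0) (left_mem_Icc.2 hab)
    (right_mem_Icc.2 hab)
  have hmono : ∫ s in (-L)..0, (Real.exp (s / ε) * (u' s + u s / ε) * u s +
      Real.exp (s / ε) * u s * u' s) ≤
      ∫ s in (-L)..0, (2 * ε * (Real.exp (s / ε) * ((u' s + u s / ε) * (u' s + u s / ε))) -
        1 / (2 * ε) * (Real.exp (s / ε) * (u s * u s))) := by
    refine intervalIntegral.integral_mono_on hab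
      ((hE.memLp.intervalIntegrable_mul hab (hu.memLp_self hL)).add
        (hEu.intervalIntegrable_mul hab hu.memLp))
      ((ipp.const_mul _).sub (iuu.const_mul _)) fun s _ => ?_
    have hexp := Real.exp_pos (s / ε)
    have : 2 * ε * (Real.exp (s / ε) * ((u' s + u s / ε) * (u' s + u s / ε))) -
        1 / (2 * ε) * (Real.exp (s / ε) * (u s * u s)) -
        (Real.exp (s / ε) * (u' s + u s / ε) * u s + Real.exp (s / ε) * u s * u' s) =
        Real.exp (s / ε) * (1 / (2 * ε)) * (2 * ε * (u' s + u s / ε) - u s) ^ 2 := by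
      field_simp
      ring
    have h2 : 0 ≤ Real.exp (s / ε) * (1 / (2 * ε)) * (2 * ε * (u' s + u s / ε) - u s) ^ 2 := by
      positivity
    linarith
  rw [hftc, intervalIntegral.integral_sub (ipp.const_mul _) (iuu.const_mul _),
    intervalIntegral.integral_const_mul, intervalIntegral.integral_const_mul] at hmono
  simp only [zero_div, Real.exp_zero, one_mul] at hmono
  rw [e1, e2]
  set I := ∫ x in (-L)..0, Real.exp (x / ε) * ((u' x + u x / ε) * (u' x + u x / ε))
  set J := ∫ x in (-L)..0, Real.exp (x / ε) * (u x * u x)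
  have hB : 0 ≤ Real.exp (-L / ε) * (u (-L) * u (-L)) :=
    mul_nonneg (Real.exp_pos _).le (mul_self_nonneg _)
  have h0 := mul_self_nonneg (u 0)
  have e3 : -(1 / (4 * ε)) * (J + ε * (Real.exp (-L / ε) * (u (-L) * u (-L)) + u 0 * u 0)) =
      -(1 / 2 * (1 / (2 * ε) * J)) - 1 / 4 * (Real.exp (-L / ε) * (u (-L) * u (-L)) + u 0 * u 0) := by
    field_simp
    ring
  rw [e3]
  linarith

theorem IsAdjointValue.smul_sub {ε L : ℝ} (hL : 0 ≤ L) {φ₁ w₁ φ₂ w₂ : StateSpace ε L} (c : ℝ)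
    (h₁ : IsAdjointValue ε L φ₁ w₁) (h₂ : IsAdjointValue ε L φ₂ w₂) :
    IsAdjointValue ε L (c • (φ₁ - φ₂)) (c • (w₁ - w₂)) := by
  have hab : -L ≤ 0 := by linarith
  obtain ⟨u₁, u₁', hu₁, he₁, hf₁⟩ := h₁
  obtain ⟨u₂, u₂', hu₂, he₂, hf₂⟩ := h₂
  refine ⟨_, _, hu₁.smul_sub c hL hu₂, ?_, fun v v' hv => ?_⟩
  · filter_upwards [Lp.coeFn_smul c (φ₁ - φ₂), Lp.coeFn_sub φ₁ φ₂, he₁, he₂] with x a1 a2 a3 a4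
    rw [a1, Pi.smul_apply, a2, Pi.sub_apply, a3, a4, smul_eq_mul]
  · have hvμ : MemLp v 2 (bulkBoundaryMeasure ε L) := by
      have h1 := (hv.memLp_self hL)
      have hsq := integrable_bulkBoundaryMeasure (ε := ε) hL (h1.intervalIntegrable_mul hab h1)
      have hm := (integrable_bulkBoundaryMeasure (ε := ε) hL
        (h1.intervalIntegrable_of_Ioo hab)).aestronglyMeasurable
      rw [memLp_two_iff_integrable_sq hm]
      simpa only [sq] using hsq
    have i1 : Integrable (fun x => w₁ x * v x) (bulkBoundaryMeasure ε L) :=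
      (Lp.memLp w₁).integrable_mul hvμ
    have i2 : Integrable (fun x => w₂ x * v x) (bulkBoundaryMeasure ε L) :=
      (Lp.memLp w₂).integrable_mul hvμ
    have e : ∫ x, (c • (w₁ - w₂)) x * v x ∂(bulkBoundaryMeasure ε L) =
        c * ((∫ x, w₁ x * v x ∂(bulkBoundaryMeasure ε L)) -
          ∫ x, w₂ x * v x ∂(bulkBoundaryMeasure ε L)) := by
      rw [← integral_sub i1 i2, ← integral_const_mul]
      apply integral_congr_ae
      filter_upwards [Lp.coeFn_smul c (w₁ - w₂), Lp.coeFn_sub w₁ w₂] with x a1 a2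
      rw [a1, Pi.smul_apply, a2, Pi.sub_apply, smul_eq_mul]
      ring
    have j1 := hv.memLp.intervalIntegrable_mul hab hu₁.memLp
    have j2 := hv.memLp.intervalIntegrable_mul hab hu₂.memLp
    have j3 := hv.memLp.intervalIntegrable_mul hab (hu₁.memLp_self hL)
    have j4 := hv.memLp.intervalIntegrable_mul hab (hu₂.memLp_self hL)
    have k1 := hf₁ v v' hv
    have k2 := hf₂ v v' hv
    simp only [formA] at k1 k2 ⊢
    have l1 : ∫ x in (-L)..0, v' x * (c * (u₁' x - u₂' x)) =
        c * ((∫ x in (-L)..0, v' x * u₁' x) - ∫ x in (-L)..0, v' x * u₂' x) := by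
      rw [← intervalIntegral.integral_sub j1 j2, ← intervalIntegral.integral_const_mul]
      congr 1; funext x; ring
    have l2 : ∫ x in (-L)..0, v' x * (c * (u₁ x - u₂ x)) =
        c * ((∫ x in (-L)..0, v' x * u₁ x) - ∫ x in (-L)..0, v' x * u₂ x) := by
      rw [← intervalIntegral.integral_sub j3 j4, ← intervalIntegral.integral_const_mul]
      congr 1; funext x; ring
    rw [e, l1, l2]
    linear_combination c * k1 - c * k2

theorem isSymmetricDissipative_isAdjointValue {ε L : ℝ} (hε : 0 < ε) (hL : 0 ≤ L) :
    IsSymmetricDissipative (weightedForm ε L) (1 / (4 * ε)) (IsAdjointValue ε L) where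
  nonneg := by positivity
  form_comm := weightedForm_comm hε hL
  form_nonneg := weightedForm_self_nonneg hε hL
  symm h₁ h₂ := h₁.symm hε hL h₂
  dissipative h := h.dissipative hε hL
  smul_sub c h₁ h₂ := h₁.smul_sub hL c h₂

/-- The representation of `φ ∈ D(A*)` by its trace at `0` and `A* φ`. -/
theorem IsAdjointValue.exists_exp_mul_eq {ε L : ℝ} (hε : 0 < ε) (hL : 0 ≤ L)
    {φ w : StateSpace ε L} (h : IsAdjointValue ε L φ w) :
    ∀ᵐ x ∂bulkBoundaryMeasure ε L, Real.exp (x / ε) * φ x = φ 0 +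
      ∫ y, w y * max 0 (Real.exp (y / ε) - Real.exp (x / ε)) ∂bulkBoundaryMeasure ε L := by
  obtain ⟨u, u', hu, he, hf⟩ := h
  have h0 : φ 0 = u 0 := ((ae_bulkBoundaryMeasure_iff hε L).1 he).2.2
  filter_upwards [he, ae_mem_Icc_bulkBoundaryMeasure hε hL] with x hx hxm
  rw [hx, h0]
  have hab : -L ≤ 0 := by linarith
  -- With this test function `v`, the integrand `ε v' u' + v' u` is `ε (e^{y/ε} u)'` to the right of
  -- `x` and `0` to the left. As `v (-L) = 0`, the term on `Γ₁` drops out.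
  have ht := IsH1.truncated_exp hε hxm
  have k := hf _ _ ht
  have hmax : max 0 (Real.exp (-L / ε) - Real.exp (x / ε)) = 0 := by
    refine max_eq_left (sub_nonpos.2 ?_)
    have := hxm.1
    gcongr
  rw [formA, hmax, ← intervalIntegral.integral_const_mul, ← intervalIntegral.integral_add
    ((ht.memLp.intervalIntegrable_mul hab hu.memLp).const_mul ε)
    (ht.memLp.intervalIntegrable_mul hab (hu.memLp_self hL)), mul_zero, zero_mul, add_zero] at k
  have e1 : ∫ y in (-L)..0, (ε * ((Ioi x).indicator (fun y => Real.exp (y / ε)) y * u' y) +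
      (Ioi x).indicator (fun y => Real.exp (y / ε)) y * u y) =
      ε * (u 0 - Real.exp (x / ε) * u x) := by
    have hftc := (IsH1.exp_div L ε).integral_deriv_mul hL hu hxm (y := 0)
      (right_mem_Icc.2 hxm.2)
    simp only [zero_div, Real.exp_zero, one_mul] at hftc
    rw [← hftc, ← intervalIntegral.integral_const_mul, intervalIntegral.integral_of_le hab,
      intervalIntegral.integral_of_le hxm.2]
    have hs : Ioc x 0 = Ioi x ∩ Ioc (-L) 0 := by
      ext y
      simp only [mem_Ioc, mem_inter_iff, mem_Ioi]
      exact ⟨fun h => ⟨h.1, hxm.1.trans_lt h.1, h.2⟩, fun h => ⟨h.1, h.2.2⟩⟩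
    rw [hs, ← Measure.restrict_restrict measurableSet_Ioi, ← integral_indicator measurableSet_Ioi]
    congr 1
    funext y
    by_cases hy : y ∈ Ioi x
    · simp only [indicator_of_mem hy]
      field_simp
      ring
    · simp only [indicator_of_notMem hy]
      ring
  have e2 : ∫ y, w y * (ε * max 0 (Real.exp (y / ε) - Real.exp (x / ε)))
      ∂bulkBoundaryMeasure ε L =
      ε * ∫ y, w y * max 0 (Real.exp (y / ε) - Real.exp (x / ε)) ∂bulkBoundaryMeasure ε L := by
    rw [← integral_const_mul]
    congr 1; funext y; ring
  rw [e1, e2] at k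
  have : ε * (Real.exp (x / ε) * u x) = ε * (u 0 +
      ∫ y, w y * max 0 (Real.exp (y / ε) - Real.exp (x / ε)) ∂bulkBoundaryMeasure ε L) := by
    linarith
  exact mul_left_cancel₀ hε.ne' this

open scoped BoundedContinuousFunction

/-! ### The trace at `0` and the integral operator inverting `A*` -/

theorem StateSpace.norm_sq_eq_integral {ε L : ℝ} (f : StateSpace ε L) :
    ‖f‖ ^ 2 = ∫ x, f x * f x ∂bulkBoundaryMeasure ε L := by
  rw [← real_inner_self_eq_norm_sq, L2.inner_def]
  simp [sq]

theorem StateSpace.mul_sq_apply_zero_le {ε L : ℝ} (hε : 0 < ε) (hL : 0 ≤ L)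
    (f : StateSpace ε L) : ε * f 0 ^ 2 ≤ ‖f‖ ^ 2 := by
  have hab : -L ≤ 0 := by linarith
  rw [f.norm_sq_eq_integral, integral_bulkBoundaryMeasure hε.le hL
    (f.memLp_restrict.intervalIntegrable_mul hab f.memLp_restrict)]
  have h1 : 0 ≤ ∫ x in (-L)..0, f x * f x :=
    intervalIntegral.integral_nonneg hab fun x _ => mul_self_nonneg _
  nlinarith [mul_nonneg hε.le (mul_self_nonneg (f (-L)))]

/-- The trace at `0`. -/
noncomputable def traceZero {ε L : ℝ} (hε : 0 < ε) (hL : 0 ≤ L) : StateSpace ε L →L[ℝ] ℝ :=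
  LinearMap.mkContinuous
    { toFun := fun f => f 0
      map_add' := fun f g => ((ae_bulkBoundaryMeasure_iff hε L).1 (Lp.coeFn_add f g)).2.2
      map_smul' := fun c f => ((ae_bulkBoundaryMeasure_iff hε L).1 (Lp.coeFn_smul c f)).2.2 }
    (√ε)⁻¹ fun f => by
      have h := f.mul_sq_apply_zero_le hε hL
      have hs := Real.sqrt_pos.2 hε
      change |f 0| ≤ _
      rw [inv_mul_eq_div, le_div_iff₀ hs]
      refine abs_le_of_sq_le_sq' ?_ (norm_nonneg f) |>.2
      rw [mul_pow, Real.sq_sqrt hε.le, sq_abs]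
      linarith

theorem traceZero_apply {ε L : ℝ} (hε : 0 < ε) (hL : 0 ≤ L) (f : StateSpace ε L) :
    traceZero hε hL f = f 0 := rfl

/-- The kernel `(e^{y/ε} - e^{x/ε})₊`, truncated outside of `[-L, 0]`. -/
noncomputable def expKernel (ε x : ℝ) : ℝ →ᵇ ℝ :=
  BoundedContinuousFunction.ofNormedAddCommGroup
    (fun y => max 0 (min 1 (Real.exp (y / ε)) - min 1 (Real.exp (x / ε)))) (by fun_prop) 1
    fun y => by
      have h1 : min 1 (Real.exp (y / ε)) ≤ 1 := min_le_left _ _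
      have h2 : 0 ≤ min 1 (Real.exp (x / ε)) := by positivity
      rw [Real.norm_of_nonneg (le_max_left _ _)]
      exact max_le zero_le_one (by linarith)

theorem expKernel_apply (ε x y : ℝ) :
    expKernel ε x y = max 0 (min 1 (Real.exp (y / ε)) - min 1 (Real.exp (x / ε))) := rfl

theorem expKernel_of_nonpos {ε x y : ℝ} (hε : 0 < ε) (hx : x ≤ 0) (hy : y ≤ 0) :
    expKernel ε x y = max 0 (Real.exp (y / ε) - Real.exp (x / ε)) := by
  rw [expKernel_apply, min_eq_right (Real.exp_le_one_iff.2 (div_nonpos_of_nonpos_of_nonneg hx hε.le)),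
    min_eq_right (Real.exp_le_one_iff.2 (div_nonpos_of_nonpos_of_nonneg hy hε.le))]

theorem norm_expKernel_le (ε x : ℝ) : ‖expKernel ε x‖ ≤ 1 :=
  BoundedContinuousFunction.norm_ofNormedAddCommGroup_le _ zero_le_one _

theorem continuous_expKernel (ε : ℝ) : Continuous (expKernel ε) := by
  rw [continuous_iff_continuousAt]
  intro x
  rw [ContinuousAt, tendsto_iff_dist_tendsto_zero]
  have hc : Continuous fun s => |min 1 (Real.exp (x / ε)) - min 1 (Real.exp (s / ε))| := by
    fun_prop
  have h0 := hc.tendsto x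
  simp only [sub_self, abs_zero] at h0
  refine squeeze_zero (fun _ => dist_nonneg) (fun s => ?_) h0
  rw [BoundedContinuousFunction.dist_le (abs_nonneg _)]
  intro y
  rw [Real.dist_eq, expKernel_apply, expKernel_apply]
  refine (abs_max_sub_max_le_max _ _ _ _).trans (max_le (by simp) (le_of_eq ?_))
  congr 1
  ring

/-- The kernel as an element of the state space. -/
noncomputable def expKernelLp (ε L x : ℝ) : StateSpace ε L :=
  BoundedContinuousFunction.toLp 2 (bulkBoundaryMeasure ε L) ℝ (expKernel ε x)

theorem norm_inner_expKernelLp_le {ε L : ℝ} (w : StateSpace ε L) (x : ℝ) :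
    ‖inner ℝ (expKernelLp ε L x) w‖ ≤
      ‖BoundedContinuousFunction.toLp (E := ℝ) 2 (bulkBoundaryMeasure ε L) ℝ‖ * ‖w‖ := by
  refine (norm_inner_le_norm _ _).trans ?_
  gcongr
  exact ContinuousLinearMap.le_of_opNorm_le_of_le _ le_rfl (norm_expKernel_le ε x)
    |>.trans (mul_one _).le

/-- The operator `w ↦ (x ↦ ∫ w(y) (e^{y/ε} - e^{x/ε})₊ dμ(y))`. -/
noncomputable def volterra (ε L : ℝ) : StateSpace ε L →L[ℝ] ℝ →ᵇ ℝ :=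
  LinearMap.mkContinuous
    { toFun := fun w => BoundedContinuousFunction.ofNormedAddCommGroup
        (fun x => inner ℝ (expKernelLp ε L x) w)
        (((ContinuousLinearMap.continuous _).comp (continuous_expKernel ε)).inner continuous_const)
        (‖BoundedContinuousFunction.toLp (E := ℝ) 2 (bulkBoundaryMeasure ε L) ℝ‖ * ‖w‖)
        (norm_inner_expKernelLp_le w)
      map_add' := fun v w => by
        ext x
        exact inner_add_right (𝕜 := ℝ) (expKernelLp ε L x) v w
      map_smul' := fun c w => by
        ext x
        exact inner_smul_right (𝕜 := ℝ) (expKernelLp ε L x) w c }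
    ‖BoundedContinuousFunction.toLp (E := ℝ) 2 (bulkBoundaryMeasure ε L) ℝ‖ fun w =>
      BoundedContinuousFunction.norm_ofNormedAddCommGroup_le _ (by positivity)
        (norm_inner_expKernelLp_le w)

theorem volterra_apply (ε L : ℝ) (w : StateSpace ε L) (x : ℝ) :
    volterra ε L w x = ∫ y, w y * expKernel ε x y ∂bulkBoundaryMeasure ε L := by
  change inner ℝ (expKernelLp ε L x) w = _
  rw [L2.inner_def]
  apply integral_congr_ae
  filter_upwards [BoundedContinuousFunction.coeFn_toLp (p := 2) (bulkBoundaryMeasure ε L) ℝ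
    (expKernel ε x)] with y hy
  rw [expKernelLp, hy]
  simp

/-- `φ ↦ e^{x/ε} φ(x) - φ(0)`. -/
noncomputable def expMulSubTrace {ε L : ℝ} (hε : 0 < ε) (hL : 0 ≤ L) :
    StateSpace ε L →L[ℝ] StateSpace ε L :=
  expMul ε L - (traceZero hε hL).smulRight
    (BoundedContinuousFunction.toLp 2 (bulkBoundaryMeasure ε L) ℝ
      (BoundedContinuousFunction.const ℝ (1 : ℝ)))

theorem expMulSubTrace_ae {ε L : ℝ} (hε : 0 < ε) (hL : 0 ≤ L) (f : StateSpace ε L) :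
    expMulSubTrace hε hL f =ᵐ[bulkBoundaryMeasure ε L]
      fun x => Real.exp (x / ε) * f x - f 0 := by
  rw [expMulSubTrace, sub_apply, ContinuousLinearMap.smulRight_apply]
  filter_upwards [Lp.coeFn_sub (expMul ε L f) (traceZero hε hL f •
      (BoundedContinuousFunction.toLp 2 (bulkBoundaryMeasure ε L) ℝ
      (BoundedContinuousFunction.const ℝ (1 : ℝ)))), expMul_ae hε hL f,
    Lp.coeFn_smul (traceZero hε hL f) (BoundedContinuousFunction.toLp 2
      (bulkBoundaryMeasure ε L) ℝ (BoundedContinuousFunction.const ℝ (1 : ℝ))),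
    BoundedContinuousFunction.coeFn_toLp (p := 2) (bulkBoundaryMeasure ε L) ℝ
      (BoundedContinuousFunction.const ℝ (1 : ℝ))] with x h1 h2 h3 h4
  rw [h1, Pi.sub_apply, h2, h3, Pi.smul_apply, h4, traceZero_apply]
  simp

/-- The integral operator `volterra`, with values in the state space. -/
noncomputable def volterraLp (ε L : ℝ) : StateSpace ε L →L[ℝ] StateSpace ε L :=
  (BoundedContinuousFunction.toLp 2 (bulkBoundaryMeasure ε L) ℝ).comp (volterra ε L)

theorem volterraLp_ae (ε L : ℝ) (w : StateSpace ε L) :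
    volterraLp ε L w =ᵐ[bulkBoundaryMeasure ε L] volterra ε L w :=
  BoundedContinuousFunction.coeFn_toLp (p := 2) (bulkBoundaryMeasure ε L) ℝ (volterra ε L w)

/-- The relation is rewritten as an equality between values of bounded operators, which commute with
time integrals; closedness of the graph is never needed. -/
theorem IsAdjointValue.expMulSubTrace_eq {ε L : ℝ} (hε : 0 < ε) (hL : 0 ≤ L)
    {φ w : StateSpace ε L} (h : IsAdjointValue ε L φ w) :
    expMulSubTrace hε hL φ = volterraLp ε L w := by
  apply Lp.ext
  have hmem := ae_mem_Icc_bulkBoundaryMeasure hε hL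
  filter_upwards [expMulSubTrace_ae hε hL φ, volterraLp_ae ε L w, h.exists_exp_mul_eq hε hL,
    hmem] with x h1 h2 h3 hx
  rw [h1, h2, h3, volterra_apply, add_sub_cancel_left]
  apply integral_congr_ae
  filter_upwards [hmem] with y hy
  rw [expKernel_of_nonpos hε hx.2 hy.2]

/-! ### The moments of an orbit against the bump functions -/

/-- The moments `∫₀^θ κₙ(τ) z(τ) dτ`. -/
noncomputable def orbitMoment {H : Type*} [NormedAddCommGroup H] [NormedSpace ℝ H] (θ M : ℝ)
    (z : ℝ → H) (n : ℕ) : H :=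
  ∫ τ in (0 : ℝ)..θ, gevreyBump θ M n τ • z τ

section Moment

variable {H E : Type*} [NormedAddCommGroup H] [NormedSpace ℝ H]
  [NormedAddCommGroup E] [NormedSpace ℝ E] {θ M T : ℝ} {z : ℝ → H}

theorem intervalIntegrable_gevreyBump_smul (hθ : 0 ≤ θ) (hM : 0 < M) (n : ℕ)
    (hz : Continuous z) :
    IntervalIntegrable (fun τ => gevreyBump θ M n τ • z τ) volume 0 θ :=
  ContinuousOn.intervalIntegrable (by
    rw [uIcc_of_le hθ]; exact (continuousOn_gevreyBump hM n).smul hz.continuousOn)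

theorem map_orbitMoment [CompleteSpace H] [CompleteSpace E] (hθ : 0 ≤ θ) (hM : 0 < M) (n : ℕ) (hz : Continuous z) (A : H →L[ℝ] E) :
    A (orbitMoment θ M z n) = ∫ τ in (0 : ℝ)..θ, gevreyBump θ M n τ • A (z τ) := by
  rw [orbitMoment, ← A.intervalIntegral_comp_comm (intervalIntegrable_gevreyBump_smul hθ hM n hz)]
  simp only [map_smul]

open scoped Nat in
theorem norm_orbitMoment_le (hθ : 0 ≤ θ) (hM : 0 < M) (n : ℕ) {B : ℝ}
    (hB : ∀ τ ∈ Icc 0 θ, ‖z τ‖ ≤ B) :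
    ‖orbitMoment θ M z n‖ ≤ (n ! : ℝ) ^ 2 * (9 / M) ^ n * B * θ := by
  have h := intervalIntegral.norm_integral_le_of_norm_le_const (a := 0) (b := θ)
    (f := fun τ => gevreyBump θ M n τ • z τ) (C := (n ! : ℝ) ^ 2 * (9 / M) ^ n * B)
    fun τ hτ => by
      rw [uIoc_of_le hθ] at hτ
      rw [norm_smul]
      exact mul_le_mul (abs_gevreyBump_le hM n τ) (hB τ (Ioc_subset_Icc_self hτ))
        (norm_nonneg _) (by positivity)
  rwa [sub_zero, abs_of_nonneg hθ] at h

/-- Integration by parts moves a derivative onto the bump and replaces `z` by its primitive, to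
which the mild equation applies. The initial value disappears because `∫ κₙ₊₁ = 0`. -/
theorem IsMildOrbit.map_orbitMoment_eq [CompleteSpace H] [CompleteSpace E] {R : H → H → Prop} (hz : IsMildOrbit R T z)
    (hθ : 0 ≤ θ) (hθT : θ ≤ T) (hM : 0 < M) {A B : H →L[ℝ] E}
    (hAB : ∀ {φ w}, R φ w → A φ = B w) (n : ℕ) :
    A (orbitMoment θ M z n) = -B (orbitMoment θ M z (n + 1)) := by
  have hc := hz.continuous
  have hZ : Continuous fun τ => ∫ s in (0 : ℝ)..τ, z s :=
    intervalIntegral.continuous_primitive (fun _ _ => hc.intervalIntegrable _ _) 0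
  have h1 : ∫ τ in (0 : ℝ)..θ, gevreyBump θ M (n + 1) τ • A (∫ s in (0 : ℝ)..τ, z s) =
      ∫ τ in (0 : ℝ)..θ, (gevreyBump θ M (n + 1) τ • B (z τ) -
        gevreyBump θ M (n + 1) τ • B (z 0)) := by
    apply intervalIntegral.integral_congr
    intro τ hτ
    rw [uIcc_of_le hθ] at hτ
    simp only
    rw [hAB (hz.mild τ ⟨hτ.1, hτ.2.trans hθT⟩), map_sub, smul_sub]
  have hBz : Continuous fun τ => B (z τ) := B.continuous.comp hc
  rw [intervalIntegral.integral_sub (intervalIntegrable_gevreyBump_smul hθ hM _ hBz)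
    (intervalIntegrable_gevreyBump_smul hθ hM _ continuous_const),
    intervalIntegral.integral_smul_const, integral_gevreyBump_succ hθ hM, zero_smul, sub_zero,
    ← map_orbitMoment hθ hM _ hc] at h1
  rw [← h1, ← map_orbitMoment hθ hM _ hZ, ← map_neg, orbitMoment,
    integral_gevreyBump_smul hθ hM n hc, orbitMoment]

end Moment

/-! ### The sideways estimate -/

/-- Writing `w = e^{-y/ε} p` turns the kernel into `1 - e^{-(y-x)/ε} ≤ (y - x)/ε` for `y ≥ x`. The
atom at `0` produces the term `-x |w 0|`; at the atom `-L` the kernel vanishes. -/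
theorem abs_volterra_le {ε L : ℝ} (hε : 0 < ε) (hL : 0 ≤ L) {w : StateSpace ε L} {p : ℝ → ℝ}
    (hp : Continuous p)
    (hwp : ∀ᵐ x ∂bulkBoundaryMeasure ε L, Real.exp (x / ε) * w x = p x) {x : ℝ}
    (hx : x ∈ Icc (-L) 0) :
    |volterra ε L w x| ≤ -x * |w 0| + 1 / ε * ∫ y in x..0, (y - x) * |p y| := by
  have hp0 : w 0 = p 0 := by
    simpa using ((ae_bulkBoundaryMeasure_iff hε L).1 hwp).2.2
  set h : ℝ → ℝ := fun y =>
    |p y| * (Real.exp (-(y / ε)) * max 0 (Real.exp (y / ε) - Real.exp (x / ε))) with hh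
  have hc : Continuous h := by fun_prop
  have hzero : ∀ y ≤ x, h y = 0 := fun y hy => by
    have : Real.exp (y / ε) ≤ Real.exp (x / ε) := by gcongr
    rw [hh]
    simp only
    rw [max_eq_left (by linarith), mul_zero, mul_zero]
  have hval : ∀ y, x ≤ y → Real.exp (-(y / ε)) * max 0 (Real.exp (y / ε) - Real.exp (x / ε)) ≤
      (y - x) / ε := fun y hy => by
    have h1 : Real.exp (x / ε) ≤ Real.exp (y / ε) := by gcongr
    have h2 := Real.add_one_le_exp (-(y / ε) + x / ε)
    rw [max_eq_right (by linarith), mul_sub, ← Real.exp_add, ← Real.exp_add, neg_add_cancel,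
      Real.exp_zero, sub_div]
    linarith
  have e1 : ∫ y, |w y * expKernel ε x y| ∂bulkBoundaryMeasure ε L =
      ∫ y, h y ∂bulkBoundaryMeasure ε L := by
    apply integral_congr_ae
    filter_upwards [hwp, ae_mem_Icc_bulkBoundaryMeasure hε hL] with y hy hym
    rw [hh]
    simp only
    rw [← hy, expKernel_of_nonpos hε hx.2 hym.2, abs_mul, abs_mul,
      abs_of_nonneg (le_max_left 0 (Real.exp (y / ε) - Real.exp (x / ε))), abs_of_pos (Real.exp_pos _), Real.exp_neg]
    field_simp
  have hint : ∫ y in (-L)..0, h y = ∫ y in x..0, h y := by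
    rw [← intervalIntegral.integral_add_adjacent_intervals (hc.intervalIntegrable (-L) x)
      (hc.intervalIntegrable x 0), add_eq_right, intervalIntegral.integral_of_le hx.1]
    exact setIntegral_eq_zero_of_forall_eq_zero fun y hy => hzero y hy.2
  have hle : ∫ y in x..0, h y ≤ 1 / ε * ∫ y in x..0, (y - x) * |p y| := by
    rw [← intervalIntegral.integral_const_mul]
    refine intervalIntegral.integral_mono_on hx.2 (hc.intervalIntegrable _ _)
      (Continuous.intervalIntegrable (by fun_prop) _ _) fun y hy => ?_
    calc h y ≤ |p y| * ((y - x) / ε) := mul_le_mul_of_nonneg_left (hval y hy.1) (abs_nonneg _)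
      _ = _ := by ring
  have h0 : ε * h 0 ≤ -x * |w 0| := by
    have := mul_le_mul_of_nonneg_left (hval 0 hx.2) (mul_nonneg hε.le (abs_nonneg (p 0)))
    rw [hp0]
    calc ε * h 0 ≤ ε * |p 0| * ((0 - x) / ε) := by rw [hh]; linarith
      _ = _ := by field_simp; ring
  rw [volterra_apply]
  refine (abs_integral_le_integral_abs).trans ?_
  rw [e1, integral_bulkBoundaryMeasure hε.le hL (hc.intervalIntegrable _ _), hzero _ hx.1, hint]
  linarith

/-- Cauchy–Schwarz against a constant. -/
theorem integral_abs_le_sqrt_mul_sqrt {θ : ℝ} (hθ : 0 < θ) {f : ℝ → ℝ} (hf : Continuous f) :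
    ∫ τ in (0 : ℝ)..θ, |f τ| ≤ √θ * √(∫ τ in (0 : ℝ)..θ, f τ ^ 2) := by
  -- `m` is the mean of `|f|`; the claim is nonnegativity of the variance.
  set m := (∫ τ in (0 : ℝ)..θ, |f τ|) / θ with hm
  have h0 : 0 ≤ ∫ τ in (0 : ℝ)..θ, (|f τ| - m) ^ 2 :=
    intervalIntegral.integral_nonneg hθ.le fun _ _ => sq_nonneg _
  have i1 : IntervalIntegrable (fun τ => f τ ^ 2) volume 0 θ :=
    Continuous.intervalIntegrable (by fun_prop) _ _
  have i2 : IntervalIntegrable (fun τ => 2 * m * |f τ|) volume 0 θ :=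
    Continuous.intervalIntegrable (by fun_prop) _ _
  have e : ∫ τ in (0 : ℝ)..θ, (|f τ| - m) ^ 2 =
      (∫ τ in (0 : ℝ)..θ, f τ ^ 2) - 2 * m * (∫ τ in (0 : ℝ)..θ, |f τ|) + θ * m ^ 2 := by
    have : ∀ τ, (|f τ| - m) ^ 2 = f τ ^ 2 - 2 * m * |f τ| + m ^ 2 := fun τ => by
      rw [sub_sq, sq_abs]; ring
    simp_rw [this]
    rw [intervalIntegral.integral_add (i1.sub i2) (by simp), intervalIntegral.integral_sub i1 i2,
      intervalIntegral.integral_const_mul, intervalIntegral.integral_const]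
    simp
  have hI : ∫ τ in (0 : ℝ)..θ, |f τ| = m * θ := by rw [hm]; field_simp
  rw [← Real.sqrt_mul hθ.le]
  apply Real.le_sqrt_of_sq_le
  rw [e, hI] at h0
  rw [hI]
  nlinarith

open scoped Nat in
theorem sq_factorial_succ_le (n : ℕ) : ((n + 1)! : ℝ) ^ 2 ≤ 4 * 4 ^ n * (2 * n)! := by
  have h1 : n + 1 ≤ 2 * 2 ^ n := by
    have := Nat.lt_two_pow_self (n := n)
    omega
  have h2 : n ! * n ! ≤ (2 * n)! := by
    rw [two_mul]
    exact Nat.le_of_dvd (Nat.factorial_pos _) (Nat.factorial_mul_factorial_dvd_factorial_add n n)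
  have h3 : (n + 1)! ^ 2 ≤ 4 * 4 ^ n * (2 * n)! := by
    calc (n + 1)! ^ 2 = (n + 1) ^ 2 * (n ! * n !) := by rw [Nat.factorial_succ]; ring
      _ ≤ (2 * 2 ^ n) ^ 2 * (2 * n)! := by gcongr
      _ = _ := by
        rw [mul_pow, ← pow_mul, mul_comm n 2, pow_mul]
        norm_num
  exact_mod_cast h3

open scoped Nat in
theorem sq_factorial_le (n : ℕ) : ((n !) : ℝ) ^ 2 ≤ (2 * n)! := by
  have h2 : n ! * n ! ≤ (2 * n)! := by
    rw [two_mul]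
    exact Nat.le_of_dvd (Nat.factorial_pos _) (Nat.factorial_mul_factorial_dvd_factorial_add n n)
  rw [sq]
  exact_mod_cast h2

/-- The first moment of an orbit is controlled by the trace of the orbit at `0`. -/
theorem IsMildOrbit.abs_exp_mul_orbitMoment_le {ε L T : ℝ} (hε : 0 < ε) (hL : 0 < L)
    (hεL : ε ≤ L) (hLT : L ≤ T) {z : ℝ → StateSpace ε L}
    (hz : IsMildOrbit (IsAdjointValue ε L) T z) :
    ∀ᵐ x ∂bulkBoundaryMeasure ε L,
      |Real.exp (x / ε) * orbitMoment L (576 * L ^ 2 / ε) z 0 x| ≤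
        2 * (√L * √(∫ τ in (0 : ℝ)..L, z τ 0 ^ 2)) := by
  -- `b = 1/(2L)` gives `b L = 1/2`, and `M` is then fixed by `9 / M = ε b² / 16`, the rate required
  -- of the traces.
  set M := 576 * L ^ 2 / ε with hM
  have hMpos : 0 < M := by positivity
  set b := 1 / (2 * L) with hb
  have hbpos : 0 < b := by positivity
  have hMb : 9 / M = ε * b ^ 2 / 16 := by
    rw [hM, hb]; field_simp; norm_num
  have hc := hz.continuous
  set tr := traceZero hε hL.le with htr
  set ω := orbitMoment L M z with hω
  -- `P n` is the continuous representative of `e^{x/ε} ωₙ`.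
  set P : ℕ → ℝ → ℝ := fun n x => ω n 0 - volterra ε L (ω (n + 1)) x with hPdef
  have hP : ∀ n, Continuous (P n) := fun n =>
    continuous_const.sub (volterra ε L (ω (n + 1))).continuous
  have hωP : ∀ n, ∀ᵐ x ∂bulkBoundaryMeasure ε L, Real.exp (x / ε) * ω n x = P n x := fun n => by
    have h := hz.map_orbitMoment_eq hL.le hLT hMpos
      (fun h => IsAdjointValue.expMulSubTrace_eq hε hL.le h) n
    have h' := Lp.coeFn_neg (volterraLp ε L (orbitMoment L M z (n + 1)))
    rw [← h] at h'
    filter_upwards [h', expMulSubTrace_ae hε hL.le (ω n), volterraLp_ae ε L (ω (n + 1))]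
      with x h1 h2 h3
    rw [← hω, h2, Pi.neg_apply, h3] at h1
    rw [hPdef]
    linarith
  -- `B` depends on the orbit, but enters only the constant `S` of the crude bound.
  obtain ⟨B, hB⟩ := (isCompact_Icc (a := (0 : ℝ)) (b := L)).exists_bound_of_continuousOn
    hc.continuousOn
  have hB0 : 0 ≤ B := (norm_nonneg _).trans (hB 0 (left_mem_Icc.2 hL.le))
  have hωn : ∀ n, ‖ω n‖ ≤ (n.factorial : ℝ) ^ 2 * (ε * b ^ 2 / 16) ^ n * B * L := fun n => by
    rw [← hMb]
    exact norm_orbitMoment_le hL.le hMpos n hB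
  have hq : 0 < ε * b ^ 2 := by positivity
  have hSle : ∀ n, ∀ x ∈ Icc (-L) 0, |P n x| ≤
      ((‖tr‖ + ‖volterra ε L‖ * (ε * b ^ 2)) * B * L) * (ε * b ^ 2 / 4) ^ n *
        (2 * n).factorial := by
    intro n x _
    have h1 : |ω n 0| ≤ ‖tr‖ * ((2 * n).factorial * (ε * b ^ 2 / 4) ^ n * B * L) := by
      refine (tr.le_opNorm (ω n)).trans (mul_le_mul_of_nonneg_left ?_ (norm_nonneg _))
      refine (hωn n).trans ?_
      gcongr
      · exact sq_factorial_le n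
      · norm_num
    have h2 : |volterra ε L (ω (n + 1)) x| ≤ ‖volterra ε L‖ *
        ((2 * n).factorial * (ε * b ^ 2 / 4) ^ n * (ε * b ^ 2) * B * L) := by
      refine ((volterra ε L (ω (n + 1))).norm_coe_le_norm x).trans
        (((volterra ε L).le_opNorm _).trans (mul_le_mul_of_nonneg_left ?_ (norm_nonneg _)))
      refine (hωn (n + 1)).trans ?_
      -- The shift to `n + 1` costs a factor `4ⁿ` in the factorials, hence the weaker rate `ε b² /
      -- 4`.
      have h4 : (ε * b ^ 2 / 16) ^ (n + 1) = (ε * b ^ 2 / 4) ^ n * (ε * b ^ 2) / (16 * 4 ^ n) := by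
        rw [pow_succ, show ε * b ^ 2 / 16 = ε * b ^ 2 / 4 / 4 by ring, div_pow _ (4 : ℝ) n]
        field_simp
        norm_num
      calc ((n + 1).factorial : ℝ) ^ 2 * (ε * b ^ 2 / 16) ^ (n + 1) * B * L ≤
          (4 * 4 ^ n * (2 * n).factorial) * (ε * b ^ 2 / 16) ^ (n + 1) * B * L := by
            gcongr
            exact sq_factorial_succ_le n
        _ = 1 / 4 * ((2 * n).factorial * (ε * b ^ 2 / 4) ^ n * (ε * b ^ 2) * B * L) := by
            rw [h4]
            field_simp
            norm_num
        _ ≤ _ := by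
            have : 0 ≤ ((2 * n).factorial * (ε * b ^ 2 / 4) ^ n * (ε * b ^ 2) * B * L) := by
              positivity
            linarith
    calc |P n x| ≤ |ω n 0| + |volterra ε L (ω (n + 1)) x| := abs_sub _ _
      _ ≤ _ := add_le_add h1 h2
      _ = _ := by ring
  have hgle : ∀ n, |ω n 0| ≤ (√L * √(∫ τ in (0 : ℝ)..L, z τ 0 ^ 2)) * (ε * b ^ 2 / 16) ^ n *
      (2 * n).factorial := by
    intro n
    have htz : Continuous fun τ => tr (z τ) := tr.continuous.comp hc
    have e : ω n 0 = ∫ τ in (0 : ℝ)..L, gevreyBump L M n τ • tr (z τ) :=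
      map_orbitMoment hL.le hMpos n hc tr
    have hcs := integral_abs_le_sqrt_mul_sqrt hL htz
    rw [e]
    calc |∫ τ in (0 : ℝ)..L, gevreyBump L M n τ • tr (z τ)|
        ≤ ∫ τ in (0 : ℝ)..L, |gevreyBump L M n τ • tr (z τ)| :=
          intervalIntegral.abs_integral_le_integral_abs hL.le
      _ ≤ ∫ τ in (0 : ℝ)..L, (2 * n).factorial * (ε * b ^ 2 / 16) ^ n * |tr (z τ)| := by
          refine intervalIntegral.integral_mono_on hL.le
            (intervalIntegrable_gevreyBump_smul hL.le hMpos n htz).abs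
            (Continuous.intervalIntegrable (by fun_prop) _ _) fun τ _ => ?_
          rw [smul_eq_mul, abs_mul]
          refine mul_le_mul_of_nonneg_right ?_ (abs_nonneg _)
          refine (abs_gevreyBump_le hMpos n τ).trans ?_
          rw [hMb]
          gcongr
          exact sq_factorial_le n
      _ = (2 * n).factorial * (ε * b ^ 2 / 16) ^ n * ∫ τ in (0 : ℝ)..L, |tr (z τ)| :=
          intervalIntegral.integral_const_mul _ _
      _ ≤ (2 * n).factorial * (ε * b ^ 2 / 16) ^ n * (√L * √(∫ τ in (0 : ℝ)..L, z τ 0 ^ 2)) :=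
          mul_le_mul_of_nonneg_left hcs (by positivity)
      _ = _ := by ring
  filter_upwards [hωP 0, ae_mem_Icc_bulkBoundaryMeasure hε hL.le] with x hx hxm
  rw [hx]
  refine abs_le_of_sideways_recursion hε hbpos (by positivity) ?_ ?_ hP (g := fun n => ω n 0)
    (fun n x hx => ?_) hgle hSle hxm
  · rw [hb, mul_one_div, div_le_one (by positivity)]
    linarith
  · rw [hb]
    field_simp
    norm_num
  · have h := abs_volterra_le hε hL.le (hP (n + 1)) (hωP (n + 1)) hx
    calc |P n x| ≤ |ω n 0| + |volterra ε L (ω (n + 1)) x| := abs_sub _ _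
      _ ≤ _ := by linarith

/-! ### The observability inequality -/

theorem weightedForm_sq_le {ε L : ℝ} (hε : 0 < ε) (hL : 0 ≤ L) (f g : StateSpace ε L) :
    weightedForm ε L f g ^ 2 ≤ weightedForm ε L f f * weightedForm ε L g g := by
  have h : ∀ t : ℝ, 0 ≤ weightedForm ε L g g * (t * t) + (2 * weightedForm ε L f g) * t +
      weightedForm ε L f f := fun t => by
    have := weightedForm_self_nonneg hε hL (f + t • g)
    simp only [map_add, add_apply, map_smul, smul_apply, smul_eq_mul,
      weightedForm_comm hε hL g f] at this
    linarith
  have := discrim_le_zero h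
  rw [discrim] at this
  linarith

theorem StateSpace.norm_sq_le_weightedForm {ε L : ℝ} (hε : 0 < ε) (hL : 0 ≤ L)
    (f : StateSpace ε L) : ‖f‖ ^ 2 ≤ Real.exp (L / ε) * weightedForm ε L f f := by
  have hff : Integrable (fun x => f x * f x) (bulkBoundaryMeasure ε L) :=
    (Lp.memLp f).integrable_mul (Lp.memLp f)
  have heff : Integrable (fun x => Real.exp (x / ε) * (f x * f x)) (bulkBoundaryMeasure ε L) := by
    refine hff.bdd_mul (c := 1) (by fun_prop) ?_
    filter_upwards [ae_mem_Icc_bulkBoundaryMeasure hε hL] with x hx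
    rw [Real.norm_of_nonneg (Real.exp_pos _).le]
    exact Real.exp_le_one_iff.2 (div_nonpos_of_nonpos_of_nonneg hx.2 hε.le)
  rw [f.norm_sq_eq_integral, weightedForm_apply hε hL, ← integral_const_mul]
  apply integral_mono_ae hff (heff.const_mul _)
  filter_upwards [ae_mem_Icc_bulkBoundaryMeasure hε hL] with x hx
  rw [← mul_assoc, ← Real.exp_add]
  refine le_mul_of_one_le_left (mul_self_nonneg _) (Real.one_le_exp ?_)
  rw [← add_div]
  exact div_nonneg (by linarith [hx.1]) hε.le

/-- Here `e^{x/ε} f² = e^{-x/ε} (e^{x/ε} f)² ≤ e^{L/ε} D²`, and the measure has total mass `L + 2ε`.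
-/
theorem weightedForm_self_le_of_abs_le {ε L D : ℝ} (hε : 0 < ε) (hL : 0 ≤ L)
    {f : StateSpace ε L}
    (hf : ∀ᵐ x ∂bulkBoundaryMeasure ε L, |Real.exp (x / ε) * f x| ≤ D) :
    weightedForm ε L f f ≤ Real.exp (L / ε) * D ^ 2 * (L + 2 * ε) := by
  have hi : IntervalIntegrable (fun _ : ℝ => Real.exp (L / ε) * D ^ 2) volume (-L) 0 := by simp
  have hμ : ∫ _, Real.exp (L / ε) * D ^ 2 ∂bulkBoundaryMeasure ε L =
      Real.exp (L / ε) * D ^ 2 * (L + 2 * ε) := by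
    rw [integral_bulkBoundaryMeasure hε.le hL hi, intervalIntegral.integral_const, smul_eq_mul]
    ring
  rw [weightedForm_apply hε hL, ← hμ]
  refine integral_mono_of_nonneg (Eventually.of_forall fun x =>
    mul_nonneg (Real.exp_pos _).le (mul_self_nonneg _)) (integrable_const _) ?_
  filter_upwards [hf, ae_mem_Icc_bulkBoundaryMeasure hε hL] with x hx hxm
  have h1 : Real.exp (x / ε) * (f x * f x) =
      Real.exp (-x / ε) * (Real.exp (x / ε) * f x) ^ 2 := by
    rw [neg_div, Real.exp_neg]
    field_simp
  rw [h1, ← sq_abs]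
  have := hxm.1
  gcongr
  linarith

/-- Observability on the time interval `(0, L)`, in the weighted norm. -/
theorem IsMildOrbit.weightedForm_le_observation {ε L T : ℝ} (hε : 0 < ε) (hL : 0 < L)
    (hεL : ε ≤ L) (hLT : L < T) {z : ℝ → StateSpace ε L}
    (hz : IsMildOrbit (IsAdjointValue ε L) T z) :
    weightedForm ε L (z L) (z L) ≤
      48 * Real.exp (9217 * L / ε) * ∫ τ in (0 : ℝ)..L, z τ 0 ^ 2 := by
  set M := 576 * L ^ 2 / ε with hM
  have hMpos : 0 < M := by positivity
  set β := weightedForm ε L with hβ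
  set ω := orbitMoment L M z 0 with hω
  set N := β (z L) (z L) with hN
  set I := ∫ τ in (0 : ℝ)..L, z τ 0 ^ 2 with hI
  have hI0 : 0 ≤ I := intervalIntegral.integral_nonneg hL.le fun _ _ => sq_nonneg _
  have hN0 : 0 ≤ N := weightedForm_self_nonneg hε hL.le _
  have hc := hz.continuous
  set K := L / 2 * Real.exp (-(8 * M / L)) with hK
  have hKpos : 0 < K := by positivity
  have hR := isSymmetricDissipative_isAdjointValue (ε := ε) hε hL.le
  -- The bump is nonnegative and `β(z τ, z L) ≥ N` for `τ ≤ L`, so nothing cancels in the average.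
  have h1 : K * N ≤ β ω (z L) := by
    have e : β ω (z L) = ∫ τ in (0 : ℝ)..L, gevreyBump L M 0 τ • β (z τ) (z L) :=
      map_orbitMoment hL.le hMpos 0 hc (β.flip (z L))
    have hcont : Continuous fun τ => β (z τ) (z L) := (β.flip (z L)).continuous.comp hc
    calc K * N ≤ (∫ τ in (0 : ℝ)..L, gevreyBump L M 0 τ) * N :=
          mul_le_mul_of_nonneg_right (integral_gevreyBump_zero_ge hL hMpos) hN0
      _ = ∫ τ in (0 : ℝ)..L, gevreyBump L M 0 τ • N := by
          rw [intervalIntegral.integral_smul_const, smul_eq_mul]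
      _ ≤ ∫ τ in (0 : ℝ)..L, gevreyBump L M 0 τ • β (z τ) (z L) := by
          refine intervalIntegral.integral_mono_on hL.le
            (intervalIntegrable_gevreyBump_smul hL.le hMpos 0 continuous_const)
            (intervalIntegrable_gevreyBump_smul hL.le hMpos 0 hcont) fun τ hτ => ?_
          exact mul_le_mul_of_nonneg_left (hz.form_self_le hR hτ.1 hτ.2 hLT)
            (gevreyBump_zero_nonneg L M τ)
      _ = _ := e.symm
  have h2 : β ω ω ≤ Real.exp (L / ε) * (2 * (√L * √I)) ^ 2 * (L + 2 * ε) :=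
    weightedForm_self_le_of_abs_le hε hL.le (hz.abs_exp_mul_orbitMoment_le hε hL hεL hLT.le)
  have h3 : (2 * (√L * √I)) ^ 2 = 4 * (L * I) := by
    rw [mul_pow, mul_pow, Real.sq_sqrt hL.le, Real.sq_sqrt hI0]
    norm_num
  have h4 : K ^ 2 * N ≤ β ω ω := by
    rcases hN0.eq_or_lt with h | h
    · rw [← h, mul_zero]
      exact weightedForm_self_nonneg hε hL.le _
    · have h5 : (K * N) ^ 2 ≤ β ω ω * N :=
        (pow_le_pow_left₀ (by positivity) h1 2).trans (weightedForm_sq_le hε hL.le _ _)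
      refine le_of_mul_le_mul_right ?_ h
      linarith
  have h6 : K ^ 2 * N ≤ Real.exp (L / ε) * (4 * (L * I)) * (3 * L) := by
    rw [h3] at h2
    refine h4.trans (h2.trans ?_)
    gcongr
    linarith
  -- The exponent is `9217 = 1 + 2 · 8 · 576`: the weight, plus the square of the mass bound for the
  -- bump.
  have h7 : K ^ 2 * (48 * Real.exp (9217 * L / ε) * I) =
      Real.exp (L / ε) * (4 * (L * I)) * (3 * L) := by
    have e1 : Real.exp (9217 * L / ε) = Real.exp (L / ε) * Real.exp (8 * M / L) ^ 2 := by
      rw [← Real.exp_nat_mul, ← Real.exp_add, hM]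
      congr 1
      field_simp
      norm_num
    rw [hK, e1, Real.exp_neg]
    field_simp
    ring
  rw [← h7] at h6
  exact le_of_mul_le_mul_left h6 (by positivity)

/-- The time-reversed adjoint solution, extended by constants, is a mild orbit. -/
theorem IsAdjointSolution.isMildOrbit {ε L T : ℝ} (hT : 0 ≤ T) {φT : StateSpace ε L}
    {φ : ℝ → StateSpace ε L} (h : IsAdjointSolution ε L T φT φ) :
    IsMildOrbit (IsAdjointValue ε L) T (fun τ => φ (T - projIcc 0 T hT τ)) where
  continuous := by
    refine h.continuousOn.comp_continuous (by fun_prop) fun τ => ?_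
    have := (projIcc 0 T hT τ).2
    exact ⟨by linarith [this.2], by linarith [this.1]⟩
  mild τ hτ := by
    have e : ∫ s in (0 : ℝ)..τ, φ (T - projIcc 0 T hT s) = ∫ s in (T - τ)..T, φ s := by
      have := intervalIntegral.integral_comp_sub_left (a := 0) (b := τ) φ T
      rw [sub_zero] at this
      rw [← this]
      apply intervalIntegral.integral_congr
      intro s hs
      rw [uIcc_of_le hτ.1] at hs
      simp only
      rw [projIcc_of_mem hT ⟨hs.1, hs.2.trans hτ.2⟩]
    have hm := h.mild (T - τ) ⟨by linarith [hτ.2], by linarith [hτ.1]⟩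
    rw [e, projIcc_of_mem hT hτ, projIcc_of_mem hT (left_mem_Icc.2 hT), sub_zero, h.final]
    exact hm

/-- In units of `1/ε`, the exponents are `L` from the change of norm, `9217 L` from the observation
on `(0, L)`, and `-(T - L)/2` from the decay on `(L, T)`. -/
theorem IsAdjointSolution.norm_sq_le {ε L T : ℝ} (hε : 0 < ε) (hL : 0 < L) (hεL : ε ≤ L)
    (hLT : L < T) {φT : StateSpace ε L} {φ : ℝ → StateSpace ε L}
    (h : IsAdjointSolution ε L T φT φ) :
    ‖φ 0‖ ^ 2 ≤ 48 * Real.exp (-((T - 18437 * L) / (2 * ε))) *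
      ∫ t in (0 : ℝ)..T, (φ t : ℝ → ℝ) 0 ^ 2 := by
  have hT : 0 ≤ T := by linarith
  set z : ℝ → StateSpace ε L := fun τ => φ (T - projIcc 0 T hT τ) with hzdef
  have hz : IsMildOrbit (IsAdjointValue ε L) T z := h.isMildOrbit hT
  have hzτ : ∀ τ ∈ Icc 0 T, z τ = φ (T - τ) := fun τ hτ => by
    rw [hzdef]
    simp only
    rw [projIcc_of_mem hT hτ]
  have hzT : φ 0 = z T := by rw [hzτ T (right_mem_Icc.2 hT), sub_self]
  have hc0 : Continuous fun τ => z τ 0 := (traceZero hε hL.le).continuous.comp hz.continuous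
  have hobs : ∫ τ in (0 : ℝ)..L, z τ 0 ^ 2 ≤ ∫ t in (0 : ℝ)..T, (φ t : ℝ → ℝ) 0 ^ 2 := by
    have e : ∫ t in (0 : ℝ)..T, (φ t : ℝ → ℝ) 0 ^ 2 = ∫ τ in (0 : ℝ)..T, z τ 0 ^ 2 := by
      have := intervalIntegral.integral_comp_sub_left (a := 0) (b := T)
        (fun t => (φ t : ℝ → ℝ) 0 ^ 2) T
      rw [sub_zero, sub_self] at this
      rw [← this]
      apply intervalIntegral.integral_congr
      intro τ hτ
      rw [uIcc_of_le hT] at hτ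
      simp only
      rw [hzτ τ hτ]
    rw [e]
    exact intervalIntegral.integral_mono_interval le_rfl hL.le hLT.le
      (Eventually.of_forall fun _ => sq_nonneg _)
      (Continuous.intervalIntegrable (by fun_prop) _ _)
  have hR := isSymmetricDissipative_isAdjointValue (ε := ε) hε hL.le
  have h1 := hz.form_le hR hL.le hLT le_rfl
  have h2 := hz.weightedForm_le_observation hε hL hεL hLT
  rw [hzT]
  calc ‖z T‖ ^ 2 ≤ Real.exp (L / ε) * weightedForm ε L (z T) (z T) :=
        (z T).norm_sq_le_weightedForm hε hL.le
    _ ≤ Real.exp (L / ε) * (Real.exp (-(2 * (1 / (4 * ε)) * (T - L))) *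
        (48 * Real.exp (9217 * L / ε) * ∫ t in (0 : ℝ)..T, (φ t : ℝ → ℝ) 0 ^ 2)) := by
      gcongr
      exact h1.trans (mul_le_mul_of_nonneg_left (h2.trans (by gcongr)) (Real.exp_pos _).le)
    _ = 48 * (Real.exp (L / ε) * Real.exp (-(2 * (1 / (4 * ε)) * (T - L))) *
        Real.exp (9217 * L / ε)) * ∫ t in (0 : ℝ)..T, (φ t : ℝ → ℝ) 0 ^ 2 := by ring
    _ = _ := by
      rw [← Real.exp_add, ← Real.exp_add]
      congr 3
      field_simp
      ring

theorem mainTheorem3 :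
    ∃ c' : ℝ, 0 < c' ∧ ∀ L T : ℝ, 0 < L → 0 < T → T / L > 8 + 32 * c' →
      ∃ C k ε₀ : ℝ, 0 < C ∧ 0 < k ∧ 0 < ε₀ ∧ ∀ ε : ℝ, 0 < ε → ε < ε₀ →
        observabilityConstant ε L T ≤ ENNReal.ofReal (C * Real.exp (-k / ε)) := by
  -- `8 + 32 · 600 = 19208` exceeds the threshold `18437`.
  refine ⟨600, by norm_num, fun L T hL _ hTL => ?_⟩
  have hTL' : 19208 * L < T := by
    rw [gt_iff_lt, lt_div_iff₀ hL] at hTL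
    linarith
  -- `7² ≥ 48`, the rate is halved by the square root, and `ε₀ = L` guarantees `ε ≤ L`.
  refine ⟨7, (T - 18437 * L) / 4, L, by norm_num, by linarith, hL, fun ε hε hεL => ?_⟩
  set K := 7 * Real.exp (-((T - 18437 * L) / 4) / ε) with hK
  have hKpos : 0 < K := by positivity
  refine iInf₂_le_of_le K.toNNReal (fun φT φ hφ => ?_) le_rfl
  rw [Real.coe_toNNReal _ hKpos.le]
  have h := hφ.norm_sq_le hε hL hεL.le (by linarith)
  have hI : 0 ≤ ∫ t in (0 : ℝ)..T, (φ t : ℝ → ℝ) 0 ^ 2 :=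
    intervalIntegral.integral_nonneg (by linarith) fun _ _ => sq_nonneg _
  refine (pow_le_pow_iff_left₀ (norm_nonneg _) (by positivity) two_ne_zero).1 ?_
  rw [mul_pow, Real.sq_sqrt hI]
  refine h.trans (mul_le_mul_of_nonneg_right ?_ hI)
  rw [hK, mul_pow, ← Real.exp_nat_mul]
  have e : ((2 : ℕ) : ℝ) * (-((T - 18437 * L) / 4) / ε) = -((T - 18437 * L) / (2 * ε)) := by
    push_cast
    field_simp
    ring
  rw [e]
  gcongr
  norm_num
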